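/- Let $H$ be a complex Hilbert space and $1\le p<\infty$. For a compact operator $a$ on $H$ let $(\sigma_n(a))_n$ be its singular values, i.e. the eigenvalues of $|a|=(a^*a)^{1/2}$ repeated according to multiplicity; let $\|a\|_p=\left(\sum_n\sigma_n(a)^p\right)^{1/p}$, let $C_p(H)$ be the space of compact operators $a$ on $H$ with $\|a\|_p<\infty$, and let $S(C_p(H))=\{a\in C_p(H):\|a\|_p=1\}$. Bounded operators $a,b$ on $H$ are called orthogonal, $a\perp b$, if $ab^*=0=b^*a$. Let $H$ and $H'$ be complex Hilbert spaces, let $1\le p<\infty$ with $p\ne 2$, and let $\Delta:S(C_p(H))\to S(C_p(H'))$ be a surjective isometry, i.e. $\Delta$ is surjective and $\|\Delta(a)-\Delta(b)\|_p=\|a-b\|_p$ for all $a,b\in S(C_p(H))$. Then, for all $a,b\in S(C_p(H))$, $a\perp b$ if and only if $\Delta(a)\perp\Delta(b)$. In particular $\dim H=\dim H'$, i.e. any orthonormal basis of $H$ and any orthonormal basis of $H'$ have the same cardinality. -/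

import Mathlib

open scoped ENNReal

/-- `∑ₙ σₙ(a) ^ p`, where `σₙ(a)` runs over the positive singular values of the compact operator `a`,
that is, over the positive eigenvalues `t` of `|a| = (a* a)^(1/2)`, each repeated according to
its multiplicity (the dimension of the eigenspace, which is finite since `a` is compact).
The eigenvalue `0` contributes nothing, as `0 < p` in all uses. -/
noncomputable def schattenSum {H : Type*} [NormedAddCommGroup H] [InnerProductSpace ℂ H]
    [CompleteSpace H] (p : ℝ) (a : H →L[ℂ] H) : ℝ≥0∞ :=
  ∑' t : Set.Ioi (0 : ℝ),
    (Module.finrank ℂ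
      (Module.End.eigenspace ((CFC.abs a : H →L[ℂ] H) : H →ₗ[ℂ] H) ((t : ℝ) : ℂ)) : ℝ≥0∞) *
      ENNReal.ofReal ((t : ℝ) ^ p)

/-- The Schatten `p`-norm `(∑ₙ σₙ(a) ^ p) ^ (1 / p)` of a compact operator, with value `∞` when
the sum diverges. -/
noncomputable def schattenNorm {H : Type*} [NormedAddCommGroup H] [InnerProductSpace ℂ H]
    [CompleteSpace H] (p : ℝ) (a : H →L[ℂ] H) : ℝ≥0∞ :=
  schattenSum p a ^ (1 / p)

/-- The Schatten-von Neumann class `C_p(H)`: the compact operators with finite `p`-norm. -/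
def schattenClass (p : ℝ) (H : Type*) [NormedAddCommGroup H] [InnerProductSpace ℂ H]
    [CompleteSpace H] : Set (H →L[ℂ] H) :=
  {a | IsCompactOperator a ∧ schattenNorm p a < ∞}

/-- The unit sphere `S(C_p(H))`. -/
def schattenSphere (p : ℝ) (H : Type*) [NormedAddCommGroup H] [InnerProductSpace ℂ H]
    [CompleteSpace H] : Set (H →L[ℂ] H) :=
  {a | a ∈ schattenClass p H ∧ schattenNorm p a = 1}

/-- Orthogonality `a ⊥ b` of bounded operators: `a b* = 0 = b* a`. -/
def OpOrthogonal {H : Type*} [NormedAddCommGroup H] [InnerProductSpace ℂ H]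
    [CompleteSpace H] (a b : H →L[ℂ] H) : Prop :=
  a * star b = 0 ∧ star b * a = 0

/-! On the unit sphere, `a ⊥ b` is equivalent to `‖a + b‖_p ^ p = ‖a - b‖_p ^ p = 2`
(`opOrthogonal_iff`): orthogonal operators have additive `p`-th powers of norms, and conversely
these values give equality in the Clarkson–McCarthy inequality, which for `p ≠ 2` forces
orthogonality (`clarkson_eq`, `orthogonal_of_clarkson_eq`). An isometry respects `‖a - b‖_p`, so
only the condition on `a + b` needs an argument.

For `1 < p` the norm is strictly convex (`eq_of_schattenSum_midpoint`). Since `Δ b` and `Δ (-b)` are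
at distance 2, it follows that `Δ (-b) = -Δ b` (`coe_neg_of_isometry`), and `‖a + b‖_p` is a
distance between points of the sphere.

For `p = 1` strict convexity fails. Instead `‖a + b‖₁ = 2` is described by distances inside the
sphere: there is a `c` such that every point at distance 2 from `c` is at distance 2 from both `a`
and `b` (`schattenSum_one_add_eq_two_iff`). A surjective isometry transports this description.

All norm estimates come from Schmidt decompositions, comparison with diagonal entries through doubly
substochastic matrices, and Jensen's inequality with its equality case. For the dimension, rank-one
projections onto a basis map to pairwise orthogonal nonzero operators, whose ranges yield an
orthonormal family of the same cardinality; the inverse direction is symmetric. -/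

open scoped NNReal InnerProductSpace

set_option linter.unusedSectionVars false

/-! ### Bessel families and Parseval's identity in extended nonnegative reals. -/

section Bessel

variable {H : Type*} [NormedAddCommGroup H] [InnerProductSpace ℂ H]

/-- Families satisfying Bessel's inequality. -/
def IsBessel {κ : Type*} (e : κ → H) : Prop :=
  ∀ x : H, ∑' k, ‖⟪e k, x⟫_ℂ‖ₑ ^ 2 ≤ ‖x‖ₑ ^ 2

lemma enorm_sq_eq_ofReal {E : Type*} [SeminormedAddGroup E] (x : E) :
    ‖x‖ₑ ^ 2 = ENNReal.ofReal (‖x‖ ^ 2) := by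
  rw [← ofReal_norm, ENNReal.ofReal_pow (norm_nonneg _)]

lemma Orthonormal.isBessel {κ : Type*} {e : κ → H} (he : Orthonormal ℂ e) : IsBessel e := by
  intro x
  simp_rw [enorm_sq_eq_ofReal]
  rw [← ENNReal.ofReal_tsum_of_nonneg (fun _ => by positivity) (he.inner_products_summable x)]
  exact ENNReal.ofReal_le_ofReal (he.tsum_inner_products_le x)

lemma IsBessel.enorm_le_one {κ : Type*} {e : κ → H} (he : IsBessel e) (k : κ) : ‖e k‖ₑ ≤ 1 := by
  have h := (ENNReal.le_tsum (f := fun j => ‖⟪e j, e k⟫_ℂ‖ₑ ^ 2) k).trans (he (e k))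
  have h' : ‖e k‖ ^ 2 * ‖e k‖ ^ 2 ≤ ‖e k‖ ^ 2 := by
    simp only [enorm_sq_eq_ofReal] at h
    rw [ENNReal.ofReal_le_ofReal_iff (by positivity)] at h
    rw [inner_self_eq_norm_sq_to_K] at h
    simpa [← sq] using h
  have h2 : ‖e k‖ ≤ 1 := by
    by_contra! hc
    nlinarith [one_lt_pow₀ hc two_ne_zero]
  rw [← ofReal_norm]
  simpa using ENNReal.ofReal_le_ofReal h2

lemma IsBessel.tsum_enorm_inner_sq_le_one {κ : Type*} {e : κ → H} (he : IsBessel e) {x : H}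
    (hx : ‖x‖ₑ ≤ 1) : ∑' k, ‖⟪e k, x⟫_ℂ‖ₑ ^ 2 ≤ 1 :=
  (he x).trans (pow_le_one' hx 2)

lemma enorm_inner_symm (x y : H) : ‖⟪x, y⟫_ℂ‖ₑ = ‖⟪y, x⟫_ℂ‖ₑ := by
  rw [← ofReal_norm, norm_inner_symm, ofReal_norm]

lemma IsBessel.tsum_enorm_inner_sq_le_one' {κ : Type*} {e : κ → H} (he : IsBessel e) {x : H}
    (hx : ‖x‖ₑ ≤ 1) : ∑' k, ‖⟪x, e k⟫_ℂ‖ₑ ^ 2 ≤ 1 := by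
  simpa only [enorm_inner_symm x] using he.tsum_enorm_inner_sq_le_one hx

lemma HilbertBasis.tsum_enorm_inner_sq {κ : Type*} (e : HilbertBasis κ ℂ H) (x : H) :
    ∑' k, ‖⟪e k, x⟫_ℂ‖ₑ ^ 2 = ‖x‖ₑ ^ 2 := by
  have h := e.hasSum_inner_mul_inner x x
  have h1 : ∀ k, ⟪x, e k⟫_ℂ * ⟪e k, x⟫_ℂ = ((‖⟪e k, x⟫_ℂ‖ ^ 2 : ℝ) : ℂ) := by
    intro k
    rw [← inner_conj_symm x (e k), ← Complex.normSq_eq_conj_mul_self, Complex.normSq_eq_norm_sq]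
  simp_rw [h1] at h
  rw [inner_self_eq_norm_sq_to_K] at h
  have h2 : HasSum (fun k => ‖⟪e k, x⟫_ℂ‖ ^ 2) (‖x‖ ^ 2) := by
    rw [← Complex.hasSum_ofReal]
    simpa using h
  simp_rw [enorm_sq_eq_ofReal]
  rw [← ENNReal.ofReal_tsum_of_nonneg (fun _ => by positivity) h2.summable, h2.tsum_eq]

end Bessel

/-! ### Eigenbases of compact symmetric operators. -/

section Spectral

variable {H : Type*} [NormedAddCommGroup H] [InnerProductSpace ℂ H] [CompleteSpace H]

/-- Bases of the separate eigenspaces are glued together. The count excludes `t = 0`, where the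
eigenspace may be infinite-dimensional and `finrank` then takes the default value `0`. -/
lemma exists_eigenbasis {H : Type*} [NormedAddCommGroup H] [InnerProductSpace ℂ H]
    [CompleteSpace H] (T : H →L[ℂ] H) (hT : IsCompactOperator T)
    (hs : (T : H →ₗ[ℂ] H).IsSymmetric) :
    ∃ (κ : ℂ → Set H) (e : HilbertBasis (Σ t, κ t) ℂ H),
      (∀ i, T (e i) = i.1 • e i) ∧
      ∀ t : ℂ, t ≠ 0 → ENat.card (κ t) =
        (Module.finrank ℂ (Module.End.eigenspace (T : H →ₗ[ℂ] H) t) : ℕ∞) := by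
  have hcl : ∀ t, IsClosed (Module.End.eigenspace (T : H →ₗ[ℂ] H) t : Set H) := by
    intro t
    have : (Module.End.eigenspace (T : H →ₗ[ℂ] H) t : Set H) = {x | T x = t • x} := by
      ext x; simp
    rw [this]
    exact isClosed_eq T.continuous (continuous_const_smul t)
  have : ∀ t, CompleteSpace (Module.End.eigenspace (T : H →ₗ[ℂ] H) t) :=
    fun t => (hcl t).completeSpace_coe
  choose w b hb using fun t => exists_hilbertBasis ℂ (Module.End.eigenspace (T : H →ₗ[ℂ] H) t)
  have hon := hs.orthogonalFamily_eigenspaces.orthonormal_sigma_orthonormal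
    (fun t => (b t).orthonormal)
  have hperp : (Submodule.span ℂ (Set.range fun a : Σ t, w t =>
      (Module.End.eigenspace (T : H →ₗ[ℂ] H) a.1).subtypeₗᵢ (b a.1 a.2)))ᗮ = ⊥ := by
    rw [eq_bot_iff, ← ContinuousLinearMap.orthogonalComplement_iSup_eigenspaces_eq_bot hT hs]
    intro x hx
    rw [← Submodule.iInf_orthogonal, Submodule.mem_iInf]
    intro t
    have hx' : ∀ k : w t, ⟪((b t k : Module.End.eigenspace (T : H →ₗ[ℂ] H) t) : H), x⟫_ℂ = 0 :=
      fun k => hx _ (Submodule.subset_span ⟨⟨t, k⟩, rfl⟩)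
    intro y hy
    have h1 := (b t).hasSum_repr ⟨y, hy⟩
    have h2 := (h1.mapL (Submodule.subtypeL _)).mapL (innerSL ℂ x)
    have h3 : ∀ k, (innerSL ℂ x) ((Submodule.subtypeL (Module.End.eigenspace (T : H →ₗ[ℂ] H) t))
        ((b t).repr ⟨y, hy⟩ k • b t k)) = 0 := by
      intro k
      have := hx' k
      rw [← inner_conj_symm, map_eq_zero] at this
      simp [this]
    simp_rw [h3] at h2
    have h4 := h2.unique hasSum_zero
    rw [← inner_conj_symm, map_eq_zero]
    simpa using h4
  let f : ∀ t, w t → H := fun t k => (k.1 : H)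
  have hf : ∀ t, Function.Injective (f t) := fun t x y h => Subtype.ext (Subtype.ext h)
  let E : (Σ t, (Set.range (f t))) ≃ Σ t, w t :=
    Equiv.sigmaCongrRight fun t => (Equiv.ofInjective (f t) (hf t)).symm
  let B := HilbertBasis.mkOfOrthogonalEqBot hon hperp
  have hB : ∀ a, B a = b a.1 a.2 := fun a => by
    simp [B]
  have hon' : Orthonormal ℂ (fun i => B (E i)) := B.orthonormal.comp _ E.injective
  refine ⟨fun t => Set.range (f t), HilbertBasis.mk hon' ?_, ?_, ?_⟩
  · have : Set.range (fun i => B (E i)) = Set.range B := E.surjective.range_comp B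
    rw [this, B.dense_span]
  · intro i
    rw [HilbertBasis.coe_mk]
    have := (b (E i).1 (E i).2).2
    rw [Module.End.mem_eigenspace_iff] at this
    rw [hB]
    exact this
  · intro t ht
    have := ContinuousLinearMap.finite_dimensional_eigenspace hT t ht
    have hli := (b t).orthonormal.linearIndependent
    have : Finite (w t) := hli.finite
    have := Fintype.ofFinite (w t)
    rw [← ENat.card_congr (Equiv.ofInjective (f t) (hf t)), ENat.card_eq_coe_fintype_card,
      Module.finrank_eq_card_basis (b t).toOrthonormalBasis.toBasis]

lemma eigenspace_abs (a : H →L[ℂ] H) {t : ℝ} (ht : 0 < t) :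
    Module.End.eigenspace ((CFC.abs a : H →L[ℂ] H) : H →ₗ[ℂ] H) (t : ℂ) =
      Module.End.eigenspace ((star a * a : H →L[ℂ] H) : H →ₗ[ℂ] H) (((t ^ 2 : ℝ)) : ℂ) := by
  set A := CFC.abs a
  have hA : A * A = star a * a := CFC.abs_mul_abs a
  have hpos : A.IsPositive := (ContinuousLinearMap.nonneg_iff_isPositive A).1 (CFC.abs_nonneg a)
  have hAA : ∀ x, A (A x) = (star a * a) x := fun x => by rw [← hA]; rfl
  ext x
  rw [Module.End.mem_eigenspace_iff, Module.End.mem_eigenspace_iff]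
  simp only [ContinuousLinearMap.coe_coe]
  rw [← hAA]
  constructor
  · intro h
    rw [h, map_smul, h, smul_smul]
    push_cast
    rw [sq]
  · intro h
    -- Since `A² - t² = (A + t)(A - t)`, this vector satisfies `A y = -t y`, which positivity of `A`
    -- allows only for `y = 0`.
    set y := A x - (t : ℂ) • x with hy
    have h1 : A y = -((t : ℂ) • y) := by
      rw [hy, map_sub, map_smul, h, smul_sub, smul_smul]
      push_cast
      rw [sq]
      abel
    have h2 := hpos.inner_nonneg_right y
    rw [h1, inner_neg_right, inner_smul_right, inner_self_eq_norm_sq_to_K] at h2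
    have h3 : 0 ≤ -(t * ‖y‖ ^ 2) := by
      have := (Complex.le_def.1 h2).1
      simpa [← Complex.ofReal_pow, ← Complex.ofReal_mul] using this
    have h4 : ‖y‖ ^ 2 = 0 := by nlinarith [sq_nonneg ‖y‖]
    have h5 : y = 0 := by simpa using h4
    rwa [hy, sub_eq_zero] at h5

end Spectral

/-! ### Schmidt decompositions of compact operators. -/

section Schmidt

variable {H : Type*} [NormedAddCommGroup H] [InnerProductSpace ℂ H] [CompleteSpace H]

/-- `a = ∑ᵢ σᵢ ⟪uᵢ, ·⟫ vᵢ` (weakly) with `u`, `v` orthonormal and `σᵢ > 0`. -/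
structure IsSchmidt {ι : Type*} (a : H →L[ℂ] H) (σ : ι → ℝ≥0) (u v : ι → H) : Prop where
  left : Orthonormal ℂ u
  right : Orthonormal ℂ v
  pos : ∀ i, 0 < σ i
  hasSum : ∀ x y, HasSum (fun i => ((σ i : ℝ) : ℂ) * (⟪u i, x⟫_ℂ * ⟪y, v i⟫_ℂ)) ⟪y, a x⟫_ℂ

namespace IsSchmidt

variable {ι : Type*} {a : H →L[ℂ] H} {σ : ι → ℝ≥0} {u v : ι → H}

lemma adjoint (h : IsSchmidt a σ u v) : IsSchmidt (star a) σ v u where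
  left := h.right
  right := h.left
  pos := h.pos
  hasSum x y := by
    have := (h.hasSum y x).star
    rw [ContinuousLinearMap.star_eq_adjoint, ContinuousLinearMap.adjoint_inner_right]
    simp only [RCLike.star_def, map_mul, inner_conj_symm, Complex.conj_ofReal] at this
    simpa only [mul_comm ⟪v _, x⟫_ℂ] using this

lemma apply_left (h : IsSchmidt a σ u v) (i : ι) : a (u i) = ((σ i : ℝ) : ℂ) • v i := by
  classical
  refine ext_inner_left ℂ fun y => ?_
  rw [inner_smul_right]
  refine (h.hasSum (u i) y).unique ?_
  convert hasSum_single i ?_ using 1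
  · simp [h.left.1 i]
  · intro j hj
    simp [h.left.2 hj]

lemma star_apply_right (h : IsSchmidt a σ u v) (i : ι) :
    (star a) (v i) = ((σ i : ℝ) : ℂ) • u i := h.adjoint.apply_left i

lemma inner_right_apply (h : IsSchmidt a σ u v) (i : ι) (x : H) :
    ⟪v i, a x⟫_ℂ = ((σ i : ℝ) : ℂ) * ⟪u i, x⟫_ℂ := by
  rw [← ContinuousLinearMap.adjoint_inner_left, ← ContinuousLinearMap.star_eq_adjoint,
    h.star_apply_right, inner_smul_left, Complex.conj_ofReal]

lemma apply_eq_zero (h : IsSchmidt a σ u v) {x : H} (hx : ∀ i, ⟪u i, x⟫_ℂ = 0) : a x = 0 := by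
  refine ext_inner_left ℂ fun y => ?_
  rw [inner_zero_right]
  refine (h.hasSum x y).unique ?_
  simp [hx]

lemma tsum_enorm_inner_sq (h : IsSchmidt a σ u v) (x : H) :
    ∑' i, (σ i : ℝ≥0∞) ^ 2 * ‖⟪u i, x⟫_ℂ‖ₑ ^ 2 = ‖a x‖ₑ ^ 2 := by
  have h1 := h.hasSum x (a x)
  have h2 : ∀ i, ((σ i : ℝ) : ℂ) * (⟪u i, x⟫_ℂ * ⟪a x, v i⟫_ℂ) =
      (((σ i : ℝ) ^ 2 * ‖⟪u i, x⟫_ℂ‖ ^ 2 : ℝ) : ℂ) := by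
    intro i
    rw [← inner_conj_symm (a x), h.inner_right_apply, map_mul, Complex.conj_ofReal]
    push_cast
    rw [← Complex.conj_mul']
    ring
  simp_rw [h2] at h1
  rw [inner_self_eq_norm_sq_to_K] at h1
  have h3 : HasSum (fun i => (σ i : ℝ) ^ 2 * ‖⟪u i, x⟫_ℂ‖ ^ 2) (‖a x‖ ^ 2) := by
    rw [← Complex.hasSum_ofReal]
    simpa using h1
  have h4 : ∀ i, (σ i : ℝ≥0∞) ^ 2 * ‖⟪u i, x⟫_ℂ‖ₑ ^ 2 =
      ENNReal.ofReal ((σ i : ℝ) ^ 2 * ‖⟪u i, x⟫_ℂ‖ ^ 2) := by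
    intro i
    rw [ENNReal.ofReal_mul (by positivity), ENNReal.ofReal_pow (by positivity),
      ENNReal.ofReal_coe_nnreal, enorm_sq_eq_ofReal]
  simp_rw [h4]
  rw [← ENNReal.ofReal_tsum_of_nonneg (fun _ => by positivity) h3.summable, h3.tsum_eq,
    enorm_sq_eq_ofReal]

lemma smul (h : IsSchmidt a σ u v) {c : ℂ} (hc : c ≠ 0) :
    IsSchmidt (c • a) (fun i => ‖c‖₊ * σ i) u (fun i => (c / ‖c‖) • v i) where
  left := h.left
  right := by
    have hn : (‖c‖ : ℂ) ≠ 0 := by simpa using hc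
    have : ‖c / (‖c‖ : ℂ)‖ = 1 := by
      rw [norm_div, Complex.norm_real, norm_norm, div_self (by simpa using hc)]
    refine ⟨fun i => by rw [norm_smul, this, h.right.1 i, one_mul], fun i j hij => ?_⟩
    simp only [inner_smul_left, inner_smul_right, h.right.2 hij, mul_zero]
  pos i := mul_pos (by simpa using hc) (h.pos i)
  hasSum x y := by
    have hn : (‖c‖ : ℂ) ≠ 0 := by simpa using hc
    rw [smul_apply, inner_smul_right]
    refine ((h.hasSum x y).mul_left c).congr_fun fun i => ?_
    rw [inner_smul_right]
    push_cast
    field_simp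

/-- The condition `a b* = 0` makes the two left systems mutually orthogonal, and `b* a = 0` does the
same for the right systems, so the decompositions can be concatenated. -/
lemma add {κ : Type*} {b : H →L[ℂ] H} {τ : κ → ℝ≥0} {s t : κ → H} (h : IsSchmidt a σ u v)
    (h' : IsSchmidt b τ s t) (hab : OpOrthogonal a b) :
    IsSchmidt (a + b) (Sum.elim σ τ) (Sum.elim u s) (Sum.elim v t) where
  left := by
    have key : ∀ i j, ⟪u i, s j⟫_ℂ = 0 := by
      intro i j
      have h1 : ⟪star a (v i), star b (t j)⟫_ℂ = 0 := by
        rw [ContinuousLinearMap.star_eq_adjoint a, ContinuousLinearMap.adjoint_inner_left]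
        have : a (star b (t j)) = (a * star b) (t j) := rfl
        rw [this, hab.1]
        simp
      rw [h.star_apply_right, h'.star_apply_right, inner_smul_left, inner_smul_right] at h1
      simpa [(h.pos i).ne', (h'.pos j).ne'] using h1
    refine ⟨?_, ?_⟩
    · rintro (i | i)
      · exact h.left.1 i
      · exact h'.left.1 i
    · rintro (i | i) (j | j) hij
      · exact h.left.2 (by simpa using hij)
      · exact key i j
      · exact inner_eq_zero_symm.1 (key j i)
      · exact h'.left.2 (by simpa using hij)
  right := by
    have key : ∀ i j, ⟪v i, t j⟫_ℂ = 0 := by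
      intro i j
      have h1 : ⟪b (s j), a (u i)⟫_ℂ = 0 := by
        rw [← ContinuousLinearMap.adjoint_inner_right, ← ContinuousLinearMap.star_eq_adjoint]
        have : star b (a (u i)) = (star b * a) (u i) := rfl
        rw [this, hab.2]
        simp
      rw [h.apply_left, h'.apply_left, inner_smul_left, inner_smul_right] at h1
      rw [inner_eq_zero_symm]
      simpa [(h.pos i).ne', (h'.pos j).ne'] using h1
    refine ⟨?_, ?_⟩
    · rintro (i | i)
      · exact h.right.1 i
      · exact h'.right.1 i
    · rintro (i | i) (j | j) hij
      · exact h.right.2 (by simpa using hij)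
      · exact key i j
      · exact inner_eq_zero_symm.1 (key j i)
      · exact h'.right.2 (by simpa using hij)
  pos := by
    rintro (i | i)
    · exact h.pos i
    · exact h'.pos i
  hasSum x y := by
    rw [add_apply, inner_add_right]
    exact HasSum.sum (by simpa [Function.comp_def] using h.hasSum x y)
      (by simpa [Function.comp_def] using h'.hasSum x y)

end IsSchmidt

lemma isSchmidt_rankOne {x y : H} (hx : ‖x‖ = 1) (hy : ‖y‖ = 1) :
    IsSchmidt (InnerProductSpace.rankOne ℂ x y) (fun _ : Unit => 1) (fun _ => y) (fun _ => x) where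
  left := ⟨fun _ => hy, fun i j h => (h (Subsingleton.elim i j)).elim⟩
  right := ⟨fun _ => hx, fun i j h => (h (Subsingleton.elim i j)).elim⟩
  pos _ := one_pos
  hasSum z w := by
    simp

lemma isCompactOperator_rankOne (x y : H) :
    IsCompactOperator (InnerProductSpace.rankOne ℂ x y : H →L[ℂ] H) := by
  rw [InnerProductSpace.rankOne_def']
  have h : IsCompactOperator (innerSL ℂ y : H →L[ℂ] ℂ) :=
    isCompactOperator_of_locallyCompactSpace_dom _
  exact h.clm_comp (ContinuousLinearMap.toSpanSingleton ℂ x)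

theorem exists_isSchmidt.{w} {H : Type w} [NormedAddCommGroup H] [InnerProductSpace ℂ H]
    [CompleteSpace H] {a : H →L[ℂ] H} (ha : IsCompactOperator a) :
    ∃ (ι : Type w) (σ : ι → ℝ≥0) (u v : ι → H), IsSchmidt a σ u v ∧
      ∀ p : ℝ, 0 < p → schattenSum p a = ∑' i, (σ i : ℝ≥0∞) ^ p := by
  have hT : IsCompactOperator (star a * a) := ha.clm_comp (star a)
  have hs : ((star a * a : H →L[ℂ] H) : H →ₗ[ℂ] H).IsSymmetric :=
    (IsSelfAdjoint.star_mul_self a).isSymmetric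
  obtain ⟨κ, e, he, hκ⟩ := exists_eigenbasis _ hT hs
  have hin : ∀ i j, ⟪a (e i), a (e j)⟫_ℂ = j.1 * ⟪e i, e j⟫_ℂ := by
    intro i j
    rw [← ContinuousLinearMap.adjoint_inner_right, ← ContinuousLinearMap.star_eq_adjoint,
      ← inner_smul_right, ← he j]
    rfl
  have hval : ∀ i, i.1 = ((‖a (e i)‖ ^ 2 : ℝ) : ℂ) := by
    intro i
    have := hin i i
    rw [inner_self_eq_norm_sq_to_K, inner_self_eq_norm_sq_to_K, e.orthonormal.1 i] at this
    simpa using this.symm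
  -- With `e` an eigenbasis of `a* a`, the vectors `a (e i)` are pairwise orthogonal; normalizing
  -- the nonzero ones gives the right system.
  refine ⟨{i // a (e i) ≠ 0}, fun i => ‖a (e i)‖₊, fun i => e i,
    fun i => ((‖a (e i)‖⁻¹ : ℝ) : ℂ) • a (e i), ⟨?_, ?_, ?_, ?_⟩, ?_⟩
  · exact e.orthonormal.comp _ Subtype.val_injective
  · refine ⟨fun i => ?_, fun i j hij => ?_⟩
    · rw [norm_smul, Complex.norm_real, norm_inv, norm_norm,
        inv_mul_cancel₀ (norm_ne_zero_iff.2 i.2)]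
    · simp only [inner_smul_left, inner_smul_right, hin]
      rw [e.orthonormal.2 (fun h => hij (Subtype.ext h))]
      simp
  · intro i
    simpa using i.2
  · intro x y
    have h1 := ((e.hasSum_repr x).mapL a).mapL (innerSL ℂ y)
    simp only [map_smul, innerSL_apply_apply, smul_eq_mul, e.repr_apply_apply] at h1
    have h2 : (fun i : {i // a (e i) ≠ 0} => (((‖a (e i)‖₊ : ℝ≥0) : ℝ) : ℂ) *
        (⟪e i, x⟫_ℂ * ⟪y, ((‖a (e i)‖⁻¹ : ℝ) : ℂ) • a (e i)⟫_ℂ)) =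
        (fun i => ⟪e i, x⟫_ℂ * ⟪y, a (e i)⟫_ℂ) ∘ (fun i : {i // a (e i) ≠ 0} => i.1) := by
      ext i
      have : ((‖a (e i)‖ : ℝ) : ℂ) ≠ 0 := by simpa using i.2
      rw [inner_smul_right]
      simp only [coe_nnnorm, Complex.ofReal_inv, Function.comp]
      field_simp
    rw [h2]
    refine (hasSum_subtype_iff_of_support_subset (s := {i | a (e i) ≠ 0}) ?_).2 h1
    intro i hi h0
    simp [h0] at hi
  · intro p hp
    have h1 : ∑' i : {i // a (e i) ≠ 0}, ((‖a (e i)‖₊ : ℝ≥0) : ℝ≥0∞) ^ p =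
        ∑' i, ((‖a (e i)‖₊ : ℝ≥0) : ℝ≥0∞) ^ p := by
      refine tsum_subtype_eq_of_support_subset (f := fun i => ((‖a (e i)‖₊ : ℝ≥0) : ℝ≥0∞) ^ p)
        (s := {i | a (e i) ≠ 0}) ?_
      intro i hi h0
      simp [h0, hp] at hi
    rw [h1, ENNReal.tsum_sigma']
    have hinj : Function.Injective (fun s : Set.Ioi (0 : ℝ) => (((s : ℝ) ^ 2 : ℝ) : ℂ)) := by
      intro s t h
      have h' : (s : ℝ) ^ 2 = (t : ℝ) ^ 2 := Complex.ofReal_injective h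
      exact Subtype.ext ((pow_left_inj₀ (le_of_lt s.2) (le_of_lt t.2) two_ne_zero).1 h')
    -- Only eigenvalues of `a* a` of the form `s ^ 2` with `s > 0` contribute, so the sum over `ℂ`
    -- becomes the sum over singular values `s`.
    rw [← hinj.tsum_eq]
    · refine tsum_congr fun s => ?_
      rw [eigenspace_abs a s.2]
      have hs0 : (((s : ℝ) ^ 2 : ℝ) : ℂ) ≠ 0 := by
        have : (s : ℝ) ≠ 0 := ne_of_gt s.2
        simpa using this
      have h3 : ∀ k : κ (((s : ℝ) ^ 2 : ℝ) : ℂ),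
          ((‖a (e ⟨(((s : ℝ) ^ 2 : ℝ) : ℂ), k⟩)‖₊ : ℝ≥0) : ℝ≥0∞) ^ p =
            ENNReal.ofReal ((s : ℝ) ^ p) := by
        intro k
        have h4 := Complex.ofReal_injective (hval ⟨(((s : ℝ) ^ 2 : ℝ) : ℂ), k⟩)
        rw [pow_left_inj₀ (le_of_lt s.2) (norm_nonneg _) two_ne_zero] at h4
        have h5 : ENNReal.ofReal s = ‖a (e ⟨(((s : ℝ) ^ 2 : ℝ) : ℂ), k⟩)‖ₑ := by
          rw [← ofReal_norm]
          exact congrArg ENNReal.ofReal h4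
        rw [← ENNReal.ofReal_rpow_of_nonneg (le_of_lt s.2) hp.le, h5]
        rfl
      simp_rw [h3]
      rw [ENNReal.tsum_const, hκ _ hs0]
      simp
    · intro t ht
      rw [Function.mem_support] at ht
      obtain ⟨k, hk⟩ : ∃ k : κ t, ((‖a (e ⟨t, k⟩)‖₊ : ℝ≥0) : ℝ≥0∞) ^ p ≠ 0 := by
        by_contra! hc
        exact ht (by simp only [hc, tsum_zero])
      have hk' : a (e ⟨t, k⟩) ≠ 0 := by
        intro h0
        simp [h0, hp] at hk
      exact ⟨⟨‖a (e ⟨t, k⟩)‖, norm_pos_iff.2 hk'⟩, (hval ⟨t, k⟩).symm⟩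

end Schmidt

/-! ### Jensen's inequality for powers under substochastic weights. -/

section Jensen

lemma ENNReal.eq_of_tsum_le_tsum {κ : Type*} {f g : κ → ℝ≥0∞} (h : ∀ i, f i ≤ g i)
    (hfg : ∑' i, g i ≤ ∑' i, f i) (hf : ∑' i, f i ≠ ∞) (i : κ) : f i = g i := by
  by_contra hne
  exact absurd hfg (not_le.2 (ENNReal.tsum_lt_tsum hf h (lt_of_le_of_ne (h i) hne)))

/-- Bernoulli's inequality at `x / s - 1`. The constant term of the tangent line is moved to the
side where it is nonnegative, so that total weight at most 1 suffices later and no subtraction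
occurs. -/
lemma Real.tangent_le_rpow {q s x : ℝ} (hq : 1 ≤ q) (hs : 0 < s) (hx : 0 ≤ x) :
    q * s ^ (q - 1) * x ≤ x ^ q + (q - 1) * s ^ q ∧
      (1 < q → x ≠ s → q * s ^ (q - 1) * x < x ^ q + (q - 1) * s ^ q) := by
  have h1 : -1 ≤ x / s - 1 := by linarith [div_nonneg hx hs.le]
  have h2 : (1 + (x / s - 1)) ^ q = x ^ q / s ^ q := by
    rw [add_sub_cancel, Real.div_rpow hx hs.le]
  have h3 : s ^ (q - 1) = s ^ q / s := by rw [Real.rpow_sub hs, Real.rpow_one]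
  have hsq : 0 < s ^ q := Real.rpow_pos_of_pos hs q
  have h4 : s ^ q * (1 + q * (x / s - 1)) = q * (s ^ q / s) * x - (q - 1) * s ^ q := by
    field_simp
    ring
  have h5 : s ^ q * (x ^ q / s ^ q) = x ^ q := by field_simp
  rw [h3]
  constructor
  · have := mul_le_mul_of_nonneg_left (one_add_mul_self_le_rpow_one_add h1 hq) hsq.le
    rw [h2, h4, h5] at this
    linarith
  · intro hq1 hxs
    have hne : x / s - 1 ≠ 0 := by
      rw [sub_ne_zero]
      exact fun h => hxs ((div_eq_one_iff_eq hs.ne').1 h)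
    have := mul_lt_mul_of_pos_left (one_add_mul_self_lt_rpow_one_add h1 hne hq1) hsq
    rw [h2, h4, h5] at this
    linarith

lemma Real.rpow_le_tangent {q s x : ℝ} (hq0 : 0 < q) (hq : q ≤ 1) (hs : 0 < s) (hx : 0 ≤ x) :
    x ^ q ≤ q * s ^ (q - 1) * x + (1 - q) * s ^ q ∧
      (q < 1 → x ≠ s → x ^ q < q * s ^ (q - 1) * x + (1 - q) * s ^ q) := by
  have h1 : -1 ≤ x / s - 1 := by linarith [div_nonneg hx hs.le]
  have h2 : (1 + (x / s - 1)) ^ q = x ^ q / s ^ q := by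
    rw [add_sub_cancel, Real.div_rpow hx hs.le]
  have h3 : s ^ (q - 1) = s ^ q / s := by rw [Real.rpow_sub hs, Real.rpow_one]
  have hsq : 0 < s ^ q := Real.rpow_pos_of_pos hs q
  have h4 : s ^ q * (1 + q * (x / s - 1)) = q * (s ^ q / s) * x + (1 - q) * s ^ q := by
    field_simp
    ring
  have h5 : s ^ q * (x ^ q / s ^ q) = x ^ q := by field_simp
  rw [h3]
  constructor
  · have := mul_le_mul_of_nonneg_left (rpow_one_add_le_one_add_mul_self h1 hq0.le hq) hsq.le
    rwa [h2, h4, h5] at this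
  · intro hq1 hxs
    have hne : x / s - 1 ≠ 0 := by
      rw [sub_ne_zero]
      exact fun h => hxs ((div_eq_one_iff_eq hs.ne').1 h)
    have := mul_lt_mul_of_pos_left (rpow_one_add_lt_one_add_mul_self h1 hne hq0 hq1) hsq
    rwa [h2, h4, h5] at this

variable {κ : Type*} {w : κ → ℝ≥0∞} {l : κ → ℝ≥0} {s : ℝ≥0} {q : ℝ}

lemma tangent_le_nnreal (hq : 1 ≤ q) (hs : 0 < s) (x : ℝ≥0) :
    q.toNNReal * s ^ (q - 1) * x ≤ x ^ q + (q - 1).toNNReal * s ^ q ∧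
      (1 < q → x ≠ s → q.toNNReal * s ^ (q - 1) * x < x ^ q + (q - 1).toNNReal * s ^ q) := by
  have h := Real.tangent_le_rpow hq (NNReal.coe_pos.2 hs) x.2
  simp only [← NNReal.coe_le_coe, ← NNReal.coe_lt_coe, NNReal.coe_mul, NNReal.coe_add,
    NNReal.coe_rpow, Real.coe_toNNReal q (by linarith), Real.coe_toNNReal (q - 1) (by linarith)]
  exact ⟨h.1, fun h1 h2 => h.2 h1 (fun h3 => h2 (NNReal.coe_injective h3))⟩

lemma nnreal_le_tangent (hq0 : 0 < q) (hq : q ≤ 1) (hs : 0 < s) (x : ℝ≥0) :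
    x ^ q ≤ q.toNNReal * s ^ (q - 1) * x + (1 - q).toNNReal * s ^ q ∧
      (q < 1 → x ≠ s → x ^ q < q.toNNReal * s ^ (q - 1) * x + (1 - q).toNNReal * s ^ q) := by
  have h := Real.rpow_le_tangent hq0 hq (NNReal.coe_pos.2 hs) x.2
  simp only [← NNReal.coe_le_coe, ← NNReal.coe_lt_coe, NNReal.coe_mul, NNReal.coe_add,
    NNReal.coe_rpow, Real.coe_toNNReal q (by linarith), Real.coe_toNNReal (1 - q) (by linarith)]
  exact ⟨h.1, fun h1 h2 => h.2 h1 (fun h3 => h2 (NNReal.coe_injective h3))⟩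

lemma tangent_mul_self (hs : 0 < s) : q.toNNReal * s ^ (q - 1) * s = q.toNNReal * s ^ q := by
  rw [mul_assoc, ← NNReal.rpow_add_one hs.ne', sub_add_cancel]

lemma tsum_tangent (w : κ → ℝ≥0∞) (l : κ → ℝ≥0) (c : ℝ≥0) :
    ∑' j, w j * ((c * l j : ℝ≥0) : ℝ≥0∞) = c * ∑' j, w j * l j := by
  rw [← ENNReal.tsum_mul_left]
  refine tsum_congr fun j => ?_
  push_cast
  ring

/-- Jensen's inequality for substochastic weights and `x ↦ x ^ q`, `1 ≤ q`, with its
equality case. -/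
lemma rpow_le_tsum_mul_rpow (hq : 1 ≤ q) (hw : ∑' j, w j ≤ 1) (hs : (s : ℝ≥0∞) ≤ ∑' j, w j * l j) :
    (s : ℝ≥0∞) ^ q ≤ ∑' j, w j * (l j : ℝ≥0∞) ^ q ∧
      ((s : ℝ≥0∞) ^ q = ∑' j, w j * (l j : ℝ≥0∞) ^ q → ∑' j, w j * l j = s ∧
        (1 < q → s ≠ 0 → ∀ j, w j ≠ 0 → l j = s)) := by
  have hq0 : 0 < q := by linarith
  rcases eq_or_ne s 0 with rfl | hs0
  · simp only [ENNReal.coe_zero, ENNReal.zero_rpow_of_pos hq0, zero_le, true_and]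
    intro h
    refine ⟨?_, fun _ h => absurd rfl h⟩
    have h1 := ENNReal.tsum_eq_zero.1 h.symm
    rw [ENNReal.tsum_eq_zero]
    intro j
    simpa [hq0, not_lt.2 hq0.le] using h1 j
  have hpos : 0 < s := pos_iff_ne_zero.2 hs0
  set c := q.toNNReal * s ^ (q - 1) with hc
  set d := (q - 1).toNNReal * s ^ q with hd
  have hcpos : c ≠ 0 := (mul_pos (Real.toNNReal_pos.2 hq0) (NNReal.rpow_pos hpos)).ne'
  have hcs : c * s = s ^ q + d := by
    rw [hc, tangent_mul_self hpos, hd]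
    have : q.toNNReal = 1 + (q - 1).toNNReal := by
      rw [← Real.toNNReal_one, ← Real.toNNReal_add zero_le_one (by linarith)]
      simp
    rw [this]
    ring
  have hcoe : (s : ℝ≥0∞) ^ q = ((s ^ q : ℝ≥0) : ℝ≥0∞) := (ENNReal.coe_rpow_of_nonneg _ hq0.le).symm
  have hlcoe : ∀ j, (l j : ℝ≥0∞) ^ q = ((l j ^ q : ℝ≥0) : ℝ≥0∞) :=
    fun j => (ENNReal.coe_rpow_of_nonneg _ hq0.le).symm
  have hterm : ∀ j, w j * ((c * l j : ℝ≥0) : ℝ≥0∞) ≤ w j * ((l j ^ q + d : ℝ≥0) : ℝ≥0∞) :=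
    fun j => mul_le_mul_right (ENNReal.coe_le_coe.2 (tangent_le_nnreal hq hpos (l j)).1) _
  have hsplit : ∑' j, w j * ((l j ^ q + d : ℝ≥0) : ℝ≥0∞) ≤
      ∑' j, w j * (l j : ℝ≥0∞) ^ q + d := by
    simp_rw [ENNReal.coe_add, mul_add, ENNReal.tsum_add, hlcoe, ENNReal.tsum_mul_right]
    gcongr
    exact mul_le_of_le_one_left' hw
  have hlow : (s : ℝ≥0∞) ^ q + d ≤ c * ∑' j, w j * l j := by
    rw [hcoe, ← ENNReal.coe_add, ← hcs, ENNReal.coe_mul]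
    gcongr
  have hmain := (hlow.trans_eq (tsum_tangent w l c).symm).trans (ENNReal.tsum_le_tsum hterm)
  constructor
  · exact (ENNReal.add_le_add_iff_right ENNReal.coe_ne_top).1 (hmain.trans hsplit)
  · intro heq
    have hfin : (s : ℝ≥0∞) ^ q + d ≠ ∞ := by rw [hcoe, ← ENNReal.coe_add]; exact ENNReal.coe_ne_top
    have hup : ∑' j, w j * ((l j ^ q + d : ℝ≥0) : ℝ≥0∞) ≤ (s : ℝ≥0∞) ^ q + d := by
      rwa [← heq] at hsplit
    have hsum : c * ∑' j, w j * l j = (s : ℝ≥0∞) ^ q + d :=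
      le_antisymm (((tsum_tangent w l c).symm.trans_le (ENNReal.tsum_le_tsum hterm)).trans hup) hlow
    constructor
    · rw [hcoe, ← ENNReal.coe_add, ← hcs, ENNReal.coe_mul] at hsum
      exact (ENNReal.mul_right_inj (ENNReal.coe_ne_zero.2 hcpos) ENNReal.coe_ne_top).1 hsum
    · intro hq1 _ j hj
      by_contra hne
      have h1 := ENNReal.eq_of_tsum_le_tsum hterm
        (hup.trans (hlow.trans_eq (tsum_tangent w l c).symm))
        (by rw [tsum_tangent, hsum]; exact hfin) j
      have hjt : w j ≠ ∞ :=
        (((ENNReal.le_tsum j).trans hw).trans_lt ENNReal.one_lt_top).ne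
      have h2 := ENNReal.coe_injective ((ENNReal.mul_right_inj hj hjt).1 h1)
      exact ((tangent_le_nnreal hq hpos (l j)).2 hq1 hne).ne h2

/-- Jensen's inequality for substochastic weights and `x ↦ x ^ q`, `0 < q ≤ 1`, with its
equality case. -/
lemma tsum_mul_rpow_le_rpow (hq0 : 0 < q) (hq : q ≤ 1) (hw : ∑' j, w j ≤ 1)
    (hs : ∑' j, w j * l j = s) :
    ∑' j, w j * (l j : ℝ≥0∞) ^ q ≤ (s : ℝ≥0∞) ^ q ∧
      ((s : ℝ≥0∞) ^ q = ∑' j, w j * (l j : ℝ≥0∞) ^ q →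
        (q < 1 → s ≠ 0 → ∀ j, w j ≠ 0 → l j = s)) := by
  rcases eq_or_ne s 0 with rfl | hs0
  · refine ⟨?_, fun _ _ h => absurd rfl h⟩
    have h1 := ENNReal.tsum_eq_zero.1 hs
    simp only [ENNReal.coe_zero, ENNReal.zero_rpow_of_pos hq0, nonpos_iff_eq_zero,
      ENNReal.tsum_eq_zero]
    intro j
    simpa [hq0, not_lt.2 hq0.le] using h1 j
  have hpos : 0 < s := pos_iff_ne_zero.2 hs0
  set c := q.toNNReal * s ^ (q - 1) with hc
  set d := (1 - q).toNNReal * s ^ q with hd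
  have hcs : c * s + d = s ^ q := by
    rw [hc, tangent_mul_self hpos, hd, ← add_mul,
      ← Real.toNNReal_add hq0.le (by linarith)]
    simp
  have hcoe : (s : ℝ≥0∞) ^ q = ((s ^ q : ℝ≥0) : ℝ≥0∞) := (ENNReal.coe_rpow_of_nonneg _ hq0.le).symm
  have hlcoe : ∀ j, (l j : ℝ≥0∞) ^ q = ((l j ^ q : ℝ≥0) : ℝ≥0∞) :=
    fun j => (ENNReal.coe_rpow_of_nonneg _ hq0.le).symm
  have hterm : ∀ j, w j * (l j : ℝ≥0∞) ^ q ≤ w j * ((c * l j + d : ℝ≥0) : ℝ≥0∞) := fun j => by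
    rw [hlcoe]
    exact mul_le_mul_right (ENNReal.coe_le_coe.2 (nnreal_le_tangent hq0 hq hpos (l j)).1) _
  have hup : ∑' j, w j * ((c * l j + d : ℝ≥0) : ℝ≥0∞) ≤ (s : ℝ≥0∞) ^ q := by
    simp_rw [ENNReal.coe_add, mul_add, ENNReal.tsum_add, tsum_tangent, hs, ENNReal.tsum_mul_right]
    rw [hcoe, ← hcs, ENNReal.coe_add, ENNReal.coe_mul c s]
    exact add_le_add le_rfl (mul_le_of_le_one_left' hw)
  refine ⟨(ENNReal.tsum_le_tsum hterm).trans hup, ?_⟩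
  intro heq hq1 _ j hj
  by_contra hne
  have h1 := ENNReal.eq_of_tsum_le_tsum hterm (hup.trans_eq heq)
    (by rw [← heq, hcoe]; exact ENNReal.coe_ne_top) j
  have hjt : w j ≠ ∞ := (((ENNReal.le_tsum j).trans hw).trans_lt ENNReal.one_lt_top).ne
  have h2 := (ENNReal.mul_right_inj hj hjt).1 h1
  rw [hlcoe] at h2
  exact ((nnreal_le_tangent hq0 hq hpos (l j)).2 hq1 hne).ne (ENNReal.coe_injective h2)

end Jensen

/-! ### Comparison of matrix entries and column norms with singular values. -/

section Diagonal

lemma ENNReal.rpow_natCast_two_mul (x : ℝ≥0∞) (p : ℝ) : (x ^ 2) ^ (p / 2) = x ^ p := by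
  rw [← ENNReal.rpow_natCast, ← ENNReal.rpow_mul]
  congr 1
  push_cast
  ring

variable {H : Type*} [NormedAddCommGroup H] [InnerProductSpace ℂ H] [CompleteSpace H]
  {ι κ : Type*} {a : H →L[ℂ] H} {σ : ι → ℝ≥0} {u v : ι → H}

/-- The substochastic matrix comparing a Schmidt system with a pair of Bessel families. -/
noncomputable def schmidtWeight (u v : ι → H) (e f : κ → H) (k : κ) (i : ι) : ℝ≥0 :=
  (‖⟪u i, e k⟫_ℂ‖₊ ^ 2 + ‖⟪f k, v i⟫_ℂ‖₊ ^ 2) / 2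

lemma coe_schmidtWeight (u v : ι → H) (e f : κ → H) (k : κ) (i : ι) :
    (schmidtWeight u v e f k i : ℝ≥0∞) =
      2⁻¹ * (‖⟪u i, e k⟫_ℂ‖ₑ ^ 2 + ‖⟪f k, v i⟫_ℂ‖ₑ ^ 2) := by
  rw [schmidtWeight, ENNReal.coe_div two_ne_zero, ENNReal.div_eq_inv_mul]
  rfl

lemma ENNReal.half_mul_add_le_one {x y : ℝ≥0∞} (hx : x ≤ 1) (hy : y ≤ 1) :
    2⁻¹ * (x + y) ≤ 1 := by
  calc 2⁻¹ * (x + y) ≤ 2⁻¹ * (1 + 1) := by gcongr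
    _ = 1 := by rw [one_add_one_eq_two]; exact ENNReal.inv_mul_cancel two_ne_zero ENNReal.ofNat_ne_top

lemma tsum_schmidtWeight_left_le_one (hu : IsBessel u) (hv : IsBessel v) {e f : κ → H}
    (he : IsBessel e) (hf : IsBessel f) (k : κ) :
    ∑' i, (schmidtWeight u v e f k i : ℝ≥0∞) ≤ 1 := by
  simp_rw [coe_schmidtWeight, ENNReal.tsum_mul_left, ENNReal.tsum_add]
  exact ENNReal.half_mul_add_le_one (hu.tsum_enorm_inner_sq_le_one (he.enorm_le_one k))
    (hv.tsum_enorm_inner_sq_le_one' (hf.enorm_le_one k))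

lemma tsum_schmidtWeight_right_le_one (hu : IsBessel u) (hv : IsBessel v) {e f : κ → H}
    (he : IsBessel e) (hf : IsBessel f) (i : ι) :
    ∑' k, (schmidtWeight u v e f k i : ℝ≥0∞) ≤ 1 := by
  simp_rw [coe_schmidtWeight, ENNReal.tsum_mul_left, ENNReal.tsum_add]
  exact ENNReal.half_mul_add_le_one (he.tsum_enorm_inner_sq_le_one' (hu.enorm_le_one i))
    (hf.tsum_enorm_inner_sq_le_one (hv.enorm_le_one i))

/-- The arithmetic–geometric mean inequality; its equality case is used in
`eq_of_tsum_inner_rpow_eq`. -/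
lemma enorm_mul_le_schmidtWeight (u v : ι → H) (e f : κ → H) (k : κ) (i : ι) :
    ‖⟪u i, e k⟫_ℂ * ⟪f k, v i⟫_ℂ‖ₑ ≤ schmidtWeight u v e f k i := by
  rw [enorm_eq_nnnorm, ENNReal.coe_le_coe, schmidtWeight, nnnorm_mul, ← NNReal.coe_le_coe]
  push_cast
  nlinarith [sq_nonneg (‖⟪u i, e k⟫_ℂ‖ - ‖⟪f k, v i⟫_ℂ‖)]

namespace IsSchmidt

lemma enorm_inner_le (h : IsSchmidt a σ u v) (e f : κ → H) (k : κ) :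
    ‖⟪f k, a (e k)⟫_ℂ‖ₑ ≤ ∑' i, (schmidtWeight u v e f k i : ℝ≥0∞) * σ i := by
  rw [← (h.hasSum (e k) (f k)).tsum_eq]
  refine enorm_tsum_le_tsum_enorm.trans (ENNReal.tsum_le_tsum fun i => ?_)
  rw [enorm_mul, mul_comm]
  gcongr
  · exact enorm_mul_le_schmidtWeight u v e f k i
  · rw [enorm_eq_nnnorm]
    simp

lemma tsum_tsum_weight_le (h : IsSchmidt a σ u v) {e f : κ → H} (he : IsBessel e)
    (hf : IsBessel f) (p : ℝ) :
    ∑' k, ∑' i, (schmidtWeight u v e f k i : ℝ≥0∞) * (σ i : ℝ≥0∞) ^ p ≤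
      ∑' i, (σ i : ℝ≥0∞) ^ p := by
  rw [ENNReal.tsum_comm]
  refine ENNReal.tsum_le_tsum fun i => ?_
  rw [ENNReal.tsum_mul_right]
  exact mul_le_of_le_one_left'
    (tsum_schmidtWeight_right_le_one h.left.isBessel h.right.isBessel he hf i)

/-- Jensen along a row of the weight matrix. Summing over `k` then uses that the columns have sum at
most 1. -/
lemma enorm_inner_rpow_le (h : IsSchmidt a σ u v) {e f : κ → H} (he : IsBessel e)
    (hf : IsBessel f) {p : ℝ} (hp : 1 ≤ p) (k : κ) :
    ‖⟪f k, a (e k)⟫_ℂ‖ₑ ^ p ≤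
      ∑' i, (schmidtWeight u v e f k i : ℝ≥0∞) * (σ i : ℝ≥0∞) ^ p :=
  (rpow_le_tsum_mul_rpow (s := ‖⟪f k, a (e k)⟫_ℂ‖₊) hp
    (tsum_schmidtWeight_left_le_one h.left.isBessel h.right.isBessel he hf k)
    (h.enorm_inner_le e f k)).1

lemma tsum_enorm_inner_rpow_le (h : IsSchmidt a σ u v) {e f : κ → H} (he : IsBessel e)
    (hf : IsBessel f) {p : ℝ} (hp : 1 ≤ p) :
    ∑' k, ‖⟪f k, a (e k)⟫_ℂ‖ₑ ^ p ≤ ∑' i, (σ i : ℝ≥0∞) ^ p :=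
  (ENNReal.tsum_le_tsum fun k => h.enorm_inner_rpow_le he hf hp k).trans
    (h.tsum_tsum_weight_le he hf p)

lemma enorm_inner_self (h : IsSchmidt a σ u v) (i : ι) : ‖⟪v i, a (u i)⟫_ℂ‖ₑ = σ i := by
  rw [h.inner_right_apply, inner_self_eq_norm_sq_to_K, h.left.1 i, enorm_eq_nnnorm]
  simp

/-- Two Schmidt systems of one operator dominate each other through the diagonal inequality, so no
matching of multiplicities is needed. -/
lemma schattenSum_eq (h : IsSchmidt a σ u v) (ha : IsCompactOperator a) {p : ℝ} (hp : 1 ≤ p) :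
    schattenSum p a = ∑' i, (σ i : ℝ≥0∞) ^ p := by
  obtain ⟨κ, τ, s, t, h', hτ⟩ := exists_isSchmidt ha
  rw [hτ p (by linarith)]
  refine le_antisymm ?_ ?_
  · have := h.tsum_enorm_inner_rpow_le h'.left.isBessel h'.right.isBessel hp
    simpa only [h'.enorm_inner_self] using this
  · have := h'.tsum_enorm_inner_rpow_le h.left.isBessel h.right.isBessel hp
    simpa only [h.enorm_inner_self] using this

/-- The equality case of `IsSchmidt.tsum_enorm_inner_rpow_le`. -/
lemma eq_of_tsum_inner_rpow_eq (h : IsSchmidt a σ u v) {e f : κ → H} (he : IsBessel e)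
    (hf : IsBessel f) {p : ℝ} (hp : 1 ≤ p) (hfin : ∑' i, (σ i : ℝ≥0∞) ^ p ≠ ∞) {x : κ → ℝ≥0}
    (hx : ∀ k, ⟪f k, a (e k)⟫_ℂ = ((x k : ℝ) : ℂ))
    (heq : ∑' i, (σ i : ℝ≥0∞) ^ p ≤ ∑' k, (x k : ℝ≥0∞) ^ p) (i : ι) :
    (∀ k, ⟪e k, u i⟫_ℂ = ⟪f k, v i⟫_ℂ) ∧ ∑' k, ‖⟪e k, u i⟫_ℂ‖ₑ ^ 2 = 1 ∧
      (1 < p → ∀ k, x k ≠ 0 → ⟪e k, u i⟫_ℂ ≠ 0 → σ i = x k) := by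
  set D := schmidtWeight u v e f with hD
  have hxe : ∀ k, ‖⟪f k, a (e k)⟫_ℂ‖ₑ = x k := fun k => by
    rw [hx, enorm_eq_nnnorm]
    simp
  have hle : ∀ k, (x k : ℝ≥0∞) ^ p ≤ ∑' i, (D k i : ℝ≥0∞) * (σ i : ℝ≥0∞) ^ p := fun k => by
    simpa only [hxe] using h.enorm_inner_rpow_le he hf hp k
  have htot := h.tsum_tsum_weight_le he hf p
  have hxfin : ∑' k, (x k : ℝ≥0∞) ^ p ≠ ∞ :=
    (((ENNReal.tsum_le_tsum hle).trans htot).trans_lt hfin.lt_top).ne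
  have hrow := ENNReal.eq_of_tsum_le_tsum hle (htot.trans heq) hxfin
  have hJ : ∀ k, _ := fun k => (rpow_le_tsum_mul_rpow (s := x k) hp
    (tsum_schmidtWeight_left_le_one h.left.isBessel h.right.isBessel he hf k)
    (by simpa only [hxe] using h.enorm_inner_le e f k)).2 (hrow k)
  -- Equality of the totals forces each column with `σ i > 0` to have full mass.
  have hcol : ∑' k, (D k i : ℝ≥0∞) = 1 := by
    have h1 : ∀ i, (∑' k, (D k i : ℝ≥0∞)) * (σ i : ℝ≥0∞) ^ p ≤ (σ i : ℝ≥0∞) ^ p := fun i =>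
      mul_le_of_le_one_left'
        (tsum_schmidtWeight_right_le_one h.left.isBessel h.right.isBessel he hf i)
    have h2 : ∑' i, (∑' k, (D k i : ℝ≥0∞)) * (σ i : ℝ≥0∞) ^ p =
        ∑' k, ∑' i, (D k i : ℝ≥0∞) * (σ i : ℝ≥0∞) ^ p := by
      rw [ENNReal.tsum_comm]
      simp_rw [ENNReal.tsum_mul_right]
    have h3 := ENNReal.eq_of_tsum_le_tsum h1
      (by rw [h2]; exact heq.trans (ENNReal.tsum_le_tsum hle))
      (by rw [h2]; exact (htot.trans_lt hfin.lt_top).ne) i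
    have hσ0 : (σ i : ℝ≥0∞) ^ p ≠ 0 :=
      (ENNReal.rpow_pos (ENNReal.coe_pos.2 (h.pos i)) ENNReal.coe_ne_top).ne'
    have hσt : (σ i : ℝ≥0∞) ^ p ≠ ∞ := ENNReal.rpow_ne_top_of_nonneg (by linarith) ENNReal.coe_ne_top
    rw [← ENNReal.mul_left_inj hσ0 hσt, h3, one_mul]
  have hker : ∀ k, ⟪e k, u i⟫_ℂ = ⟪f k, v i⟫_ℂ := by
    intro k
    have h1 : HasSum (fun i => ((D k i : ℝ) * σ i)) (x k) := by
      have := (hJ k).1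
      have h2 : HasSum (fun i => (((D k i * σ i : ℝ≥0)) : ℝ≥0∞)) (x k) := by
        rw [← this]
        simp only [ENNReal.coe_mul]
        exact ENNReal.summable.hasSum
      rw [ENNReal.hasSum_coe, ← NNReal.hasSum_coe] at h2
      simpa using h2
    have h3 := Complex.hasSum_re (h.hasSum (e k) (f k))
    rw [hx, Complex.ofReal_re] at h3
    have h4 := h1.sub h3
    rw [sub_self] at h4
    -- The defect in the arithmetic–geometric mean step is a sum of weighted squares; it is zero,
    -- hence each square is.
    have h5 : ∀ i, (D k i : ℝ) * σ i -
        (((σ i : ℝ) : ℂ) * (⟪u i, e k⟫_ℂ * ⟪f k, v i⟫_ℂ)).re =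
        σ i / 2 * ‖⟪e k, u i⟫_ℂ - ⟪f k, v i⟫_ℂ‖ ^ 2 := by
      intro i
      rw [Complex.re_ofReal_mul, hD, schmidtWeight, ← inner_conj_symm (u i) (e k)]
      rw [← Complex.normSq_eq_norm_sq]
      push_cast
      rw [RCLike.norm_conj, ← Complex.normSq_eq_norm_sq,
        ← Complex.normSq_eq_norm_sq, Complex.normSq_sub]
      simp only [Complex.normSq_apply, Complex.mul_re, Complex.conj_re, Complex.conj_im]
      ring
    simp_rw [h5] at h4
    have h6 := (hasSum_zero_iff_of_nonneg (fun i => by positivity)).1 h4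
    have h7 := congrFun h6 i
    have h8 : (σ i : ℝ) ≠ 0 := by exact_mod_cast (h.pos i).ne'
    simpa [h8, sub_eq_zero] using h7
  refine ⟨hker, ?_, ?_⟩
  · rw [← hcol]
    refine tsum_congr fun k => ?_
    rw [hD, coe_schmidtWeight, enorm_inner_symm (u i), hker k, ← two_mul, ← mul_assoc,
      ENNReal.inv_mul_cancel two_ne_zero ENNReal.ofNat_ne_top, one_mul]
  · intro hp1 k hxk hek
    refine (hJ k).2 hp1 hxk i ?_
    rw [coe_schmidtWeight]
    simp only [ne_eq, mul_eq_zero, ENNReal.inv_eq_zero, ENNReal.ofNat_ne_top, false_or,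
      add_eq_zero, not_and]
    intro h0
    rw [enorm_inner_symm] at h0
    simp [hek] at h0

/-- Column norms in a Hilbert basis compare with singular values: exponents `p ≤ 2`. -/
lemma tsum_rpow_le_tsum_enorm_rpow (h : IsSchmidt a σ u v) (e : HilbertBasis κ ℂ H) {p : ℝ}
    (hp0 : 0 < p) (hp : p ≤ 2) : ∑' i, (σ i : ℝ≥0∞) ^ p ≤ ∑' k, ‖a (e k)‖ₑ ^ p := by
  have h1 : ∀ k, ∑' i, ‖⟪u i, e k⟫_ℂ‖ₑ ^ 2 * (σ i : ℝ≥0∞) ^ p ≤ ‖a (e k)‖ₑ ^ p := by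
    intro k
    have := (tsum_mul_rpow_le_rpow (q := p / 2) (w := fun i => ‖⟪u i, e k⟫_ℂ‖ₑ ^ 2)
      (l := fun i => σ i ^ 2) (s := ‖a (e k)‖₊ ^ 2) (by linarith) (by linarith)
      (h.left.isBessel.tsum_enorm_inner_sq_le_one (e.orthonormal.isBessel.enorm_le_one k))
      (by simpa [mul_comm, enorm_eq_nnnorm] using h.tsum_enorm_inner_sq (e k))).1
    simpa [ENNReal.rpow_natCast_two_mul, enorm_eq_nnnorm] using this
  refine le_trans ?_ (ENNReal.tsum_le_tsum h1)
  rw [ENNReal.tsum_comm]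
  refine ENNReal.tsum_le_tsum fun i => ?_
  have h2 : ‖u i‖ₑ = 1 := by rw [← ofReal_norm, h.left.1 i, ENNReal.ofReal_one]
  simp_rw [ENNReal.tsum_mul_right, enorm_inner_symm (u i), e.tsum_enorm_inner_sq, h2]
  simp

/-- Column norms in a Hilbert basis compare with singular values: exponents `2 ≤ p`. -/
lemma tsum_enorm_rpow_le_tsum_rpow (h : IsSchmidt a σ u v) (e : HilbertBasis κ ℂ H) {p : ℝ}
    (hp : 2 ≤ p) : ∑' k, ‖a (e k)‖ₑ ^ p ≤ ∑' i, (σ i : ℝ≥0∞) ^ p := by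
  have h1 : ∀ k, ‖a (e k)‖ₑ ^ p ≤ ∑' i, ‖⟪u i, e k⟫_ℂ‖ₑ ^ 2 * (σ i : ℝ≥0∞) ^ p := by
    intro k
    have := (rpow_le_tsum_mul_rpow (q := p / 2) (w := fun i => ‖⟪u i, e k⟫_ℂ‖ₑ ^ 2)
      (l := fun i => σ i ^ 2) (s := ‖a (e k)‖₊ ^ 2) (by linarith)
      (h.left.isBessel.tsum_enorm_inner_sq_le_one (e.orthonormal.isBessel.enorm_le_one k))
      (by simpa [mul_comm, enorm_eq_nnnorm] using (h.tsum_enorm_inner_sq (e k)).ge)).1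
    simpa [ENNReal.rpow_natCast_two_mul, enorm_eq_nnnorm] using this
  refine (ENNReal.tsum_le_tsum h1).trans ?_
  rw [ENNReal.tsum_comm]
  refine ENNReal.tsum_le_tsum fun i => ?_
  have h2 : ‖u i‖ₑ = 1 := by rw [← ofReal_norm, h.left.1 i, ENNReal.ofReal_one]
  simp_rw [ENNReal.tsum_mul_right, enorm_inner_symm (u i), e.tsum_enorm_inner_sq, h2]
  simp

end IsSchmidt

end Diagonal

/-! ### The Clarkson–McCarthy inequalities and their equality case. -/

section Clarkson

variable {H : Type*} [NormedAddCommGroup H] [InnerProductSpace ℂ H] [CompleteSpace H]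
  {ι κ : Type*} {a b : H →L[ℂ] H} {σ : ι → ℝ≥0} {u v : ι → H}
  {e : HilbertBasis κ ℂ H} {l : κ → ℝ≥0}

lemma inner_gram (a b : H →L[ℂ] H) (x y : H) :
    ⟪x, (star a * a + star b * b) y⟫_ℂ = ⟪a x, a y⟫_ℂ + ⟪b x, b y⟫_ℂ := by
  rw [add_apply, inner_add_right, ContinuousLinearMap.star_eq_adjoint,
    ContinuousLinearMap.star_eq_adjoint, mul_apply_eq_comp,
    mul_apply_eq_comp, ContinuousLinearMap.adjoint_inner_right,
    ContinuousLinearMap.adjoint_inner_right]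

/-- The operator `C = a* a + b* b` mediates: for `2 ≤ p`, `tr C ^ (p / 2)` dominates the sum of the
`p`-th powers of the norms of `a` and `b`, and twice it is dominated by the corresponding sum for `a
± b`. For `p ≤ 2` both inequalities reverse. -/
lemma exists_gram_eigenbasis.{w} {H : Type w} [NormedAddCommGroup H] [InnerProductSpace ℂ H]
    [CompleteSpace H] {a b : H →L[ℂ] H} (hC : IsCompactOperator (star a * a + star b * b)) :
    ∃ (κ : Type w) (e : HilbertBasis κ ℂ H) (l : κ → ℝ≥0),
      ∀ k, (star a * a + star b * b) (e k) = ((l k : ℝ) : ℂ) • e k := by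
  have hs : ((star a * a + star b * b : H →L[ℂ] H) : H →ₗ[ℂ] H).IsSymmetric :=
    ((IsSelfAdjoint.star_mul_self a).add (IsSelfAdjoint.star_mul_self b)).isSymmetric
  obtain ⟨κ, e, he, -⟩ := exists_eigenbasis _ hC hs
  refine ⟨_, e, fun k => ‖a (e k)‖₊ ^ 2 + ‖b (e k)‖₊ ^ 2, fun k => ?_⟩
  have h1 := inner_gram a b (e k) (e k)
  rw [he, inner_smul_right] at h1
  simp only [inner_self_eq_norm_sq_to_K, e.orthonormal.1 k] at h1
  rw [he]
  congr 1
  simpa using h1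

variable (he : ∀ k, (star a * a + star b * b) (e k) = ((l k : ℝ) : ℂ) • e k)

include he

lemma tsum_gram (x : H) :
    ∑' k, (l k : ℝ≥0∞) * ‖⟪e k, x⟫_ℂ‖ₑ ^ 2 = ‖a x‖ₑ ^ 2 + ‖b x‖ₑ ^ 2 := by
  have hs : ((star a * a + star b * b : H →L[ℂ] H) : H →ₗ[ℂ] H).IsSymmetric :=
    ((IsSelfAdjoint.star_mul_self a).add (IsSelfAdjoint.star_mul_self b)).isSymmetric
  have h1 := e.hasSum_inner_mul_inner x ((star a * a + star b * b) x)
  have h2 : ∀ k, ⟪x, e k⟫_ℂ * ⟪e k, (star a * a + star b * b) x⟫_ℂ =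
      ((l k * ‖⟪e k, x⟫_ℂ‖ ^ 2 : ℝ) : ℂ) := by
    intro k
    have h3 : ⟪e k, (star a * a + star b * b) x⟫_ℂ = ((l k : ℝ) : ℂ) * ⟪e k, x⟫_ℂ := by
      have := hs (e k) x
      simp only [ContinuousLinearMap.coe_coe] at this
      rw [← this, he, inner_smul_left, Complex.conj_ofReal]
    rw [h3, ← inner_conj_symm x (e k)]
    push_cast
    rw [← Complex.conj_mul']
    ring
  simp_rw [h2, inner_gram, inner_self_eq_norm_sq_to_K] at h1
  have h3 : HasSum (fun k => (l k : ℝ) * ‖⟪e k, x⟫_ℂ‖ ^ 2) (‖a x‖ ^ 2 + ‖b x‖ ^ 2) := by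
    rw [← Complex.hasSum_ofReal]
    simpa using h1
  have h4 : ∀ k, (l k : ℝ≥0∞) * ‖⟪e k, x⟫_ℂ‖ₑ ^ 2 =
      ENNReal.ofReal (l k * ‖⟪e k, x⟫_ℂ‖ ^ 2) := fun k => by
    rw [ENNReal.ofReal_mul (by positivity), ENNReal.ofReal_coe_nnreal, enorm_sq_eq_ofReal]
  simp_rw [h4]
  rw [← ENNReal.ofReal_tsum_of_nonneg (fun _ => by positivity) h3.summable, h3.tsum_eq,
    enorm_sq_eq_ofReal, enorm_sq_eq_ofReal, ENNReal.ofReal_add (by positivity) (by positivity)]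

lemma enorm_sq_add_enorm_sq (k : κ) : ‖a (e k)‖ₑ ^ 2 + ‖b (e k)‖ₑ ^ 2 = l k := by
  classical
  rw [← tsum_gram he, tsum_eq_single k]
  · simp [e.orthonormal.1 k, ← ofReal_norm]
  · intro j hj
    simp [e.orthonormal.2 hj]

lemma inner_eq_zero_of_gram_eq_zero (h : IsSchmidt a σ u v) {k : κ} (hk : l k = 0) (i : ι) :
    ⟪u i, e k⟫_ℂ = 0 := by
  have h1 := enorm_sq_add_enorm_sq he k
  rw [hk] at h1
  have h2 : a (e k) = 0 := by
    have := (add_eq_zero.1 h1).1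
    simpa using this
  have h3 := h.inner_right_apply i (e k)
  rw [h2, inner_zero_right] at h3
  simpa [(h.pos i).ne'] using h3.symm

/-- The sum is formally `‖C ^ (-1/2) a* v i‖ ^ 2`, which is at most 1 because `a* a ≤ C`. Where `l k
= 0` the convention `0⁻¹ = 0` removes the term. -/
lemma sum_weight_le_one (h : IsSchmidt a σ u v) (i : ι) :
    ∑' k, (((σ i) ^ 2 * ‖⟪u i, e k⟫_ℂ‖₊ ^ 2 * (l k)⁻¹ : ℝ≥0) : ℝ≥0∞) ≤ 1 := by
  classical
  rw [ENNReal.tsum_eq_iSup_sum]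
  refine iSup_le fun F => ?_
  rw [← ENNReal.ofNNReal_finsetSum]
  norm_cast
  set s : ℝ≥0 := ∑ k ∈ F, ‖⟪u i, e k⟫_ℂ‖₊ ^ 2 * (l k)⁻¹ with hs
  have hsum : ∑ k ∈ F, (σ i) ^ 2 * ‖⟪u i, e k⟫_ℂ‖₊ ^ 2 * (l k)⁻¹ = σ i ^ 2 * s := by
    rw [hs, Finset.mul_sum]
    simp_rw [mul_assoc]
  rw [hsum]
  -- The test vector `C⁻¹ u i`, cut off to `F`. It gives `σ² s² ≤ ⟪w, C w⟫ = s`, hence `σ² s ≤ 1`.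
  set w : H := ∑ k ∈ F, ((((l k)⁻¹ : ℝ≥0) : ℝ) * ⟪e k, u i⟫_ℂ) • e k with hw
  have hew : ∀ k, ⟪e k, w⟫_ℂ = if k ∈ F then ((((l k)⁻¹ : ℝ≥0) : ℝ) * ⟪e k, u i⟫_ℂ) else 0 := by
    intro k
    split_ifs with hk
    · exact e.orthonormal.inner_right_sum _ hk
    · rw [hw, inner_sum]
      refine Finset.sum_eq_zero fun j hj => ?_
      have hkj : k ≠ j := by
        rintro rfl
        exact hk hj
      rw [inner_smul_right, e.orthonormal.2 hkj, mul_zero]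
  have huw : ⟪u i, w⟫_ℂ = ((s : ℝ) : ℂ) := by
    rw [hw, inner_sum, hs]
    push_cast
    refine Finset.sum_congr rfl fun k _ => ?_
    rw [inner_smul_right, ← inner_conj_symm (e k), ← Complex.conj_mul']
    ring
  have hle : (σ i : ℝ≥0∞) ^ 2 * s ^ 2 ≤ s := by
    calc (σ i : ℝ≥0∞) ^ 2 * s ^ 2 = ‖⟪v i, a w⟫_ℂ‖ₑ ^ 2 := by
          rw [h.inner_right_apply, huw, enorm_eq_nnnorm]
          simp [mul_pow]
      _ ≤ ‖a w‖ₑ ^ 2 := by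
          refine (ENNReal.le_tsum (f := fun i => ‖⟪v i, a w⟫_ℂ‖ₑ ^ 2) i).trans
            (h.right.isBessel (a w))
      _ ≤ ‖a w‖ₑ ^ 2 + ‖b w‖ₑ ^ 2 := le_self_add
      _ = ∑' k, (l k : ℝ≥0∞) * ‖⟪e k, w⟫_ℂ‖ₑ ^ 2 := (tsum_gram he w).symm
      _ = ∑ k ∈ F, (l k : ℝ≥0∞) * ‖⟪e k, w⟫_ℂ‖ₑ ^ 2 := by
          refine tsum_eq_sum fun k hk => ?_
          simp [hew, hk]
      _ = s := by
          rw [hs, ENNReal.ofNNReal_finsetSum]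
          refine Finset.sum_congr rfl fun k hk => ?_
          rw [hew, if_pos hk, enorm_eq_nnnorm, ← ENNReal.coe_pow, ← ENNReal.coe_mul,
            ENNReal.coe_inj, ← NNReal.coe_inj]
          push_cast
          rw [norm_mul, norm_inner_symm, norm_inv, Complex.norm_real, Real.norm_of_nonneg (by positivity)]
          rcases eq_or_ne (l k) 0 with h0 | h0
          · simp [h0]
          · have : (l k : ℝ) ≠ 0 := by exact_mod_cast h0
            field_simp
  have hle' : (σ i) ^ 2 * s ^ 2 ≤ s := by exact_mod_cast hle
  rcases eq_or_ne s 0 with h0 | h0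
  · simp [h0]
  · rw [sq s, ← mul_assoc] at hle'
    exact (mul_le_iff_le_one_left (pos_iff_ne_zero.2 h0)).1 hle'

lemma weight_mul (h : IsSchmidt a σ u v) (i : ι) (k : κ) :
    (((σ i) ^ 2 * ‖⟪u i, e k⟫_ℂ‖₊ ^ 2 * (l k)⁻¹ : ℝ≥0) : ℝ≥0∞) * l k =
      (σ i : ℝ≥0∞) ^ 2 * ‖⟪u i, e k⟫_ℂ‖ₑ ^ 2 := by
  rcases eq_or_ne (l k) 0 with h0 | h0
  · simp [h0, inner_eq_zero_of_gram_eq_zero he h h0]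
  · rw [← ENNReal.coe_mul, mul_assoc, inv_mul_cancel₀ h0]
    simp [enorm_eq_nnnorm]

lemma tsum_weight_mul (h : IsSchmidt a σ u v) (i : ι) :
    ∑' k, (((σ i) ^ 2 * ‖⟪u i, e k⟫_ℂ‖₊ ^ 2 * (l k)⁻¹ : ℝ≥0) : ℝ≥0∞) * l k =
      ((σ i ^ 2 : ℝ≥0) : ℝ≥0∞) := by
  have h2 : ‖u i‖ₑ = 1 := by rw [← ofReal_norm, h.left.1 i, ENNReal.ofReal_one]
  simp_rw [weight_mul he h, ENNReal.tsum_mul_left, enorm_inner_symm (u i), e.tsum_enorm_inner_sq,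
    h2]
  simp

omit he in
lemma tsum_tsum_weight_mul_rpow (h : IsSchmidt a σ u v) (q : ℝ) :
    ∑' i, ∑' k, (((σ i) ^ 2 * ‖⟪u i, e k⟫_ℂ‖₊ ^ 2 * (l k)⁻¹ : ℝ≥0) : ℝ≥0∞) * (l k : ℝ≥0∞) ^ q =
      ∑' k, ‖a (e k)‖ₑ ^ 2 * ((l k)⁻¹ : ℝ≥0) * (l k : ℝ≥0∞) ^ q := by
  rw [ENNReal.tsum_comm]
  refine tsum_congr fun k => ?_
  rw [ENNReal.tsum_mul_right, ← h.tsum_enorm_inner_sq]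
  push_cast
  rw [ENNReal.tsum_mul_right]
  rfl

lemma tsum_gram_rpow {q : ℝ} (hq : 0 < q) :
    ∑' k, ‖a (e k)‖ₑ ^ 2 * ((l k)⁻¹ : ℝ≥0) * (l k : ℝ≥0∞) ^ q +
      ∑' k, ‖b (e k)‖ₑ ^ 2 * ((l k)⁻¹ : ℝ≥0) * (l k : ℝ≥0∞) ^ q = ∑' k, (l k : ℝ≥0∞) ^ q := by
  rw [← ENNReal.tsum_add]
  refine tsum_congr fun k => ?_
  rw [← add_mul, ← add_mul, enorm_sq_add_enorm_sq he]
  rcases eq_or_ne (l k) 0 with h0 | h0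
  · simp [h0, hq]
  · rw [← ENNReal.coe_mul, mul_inv_cancel₀ h0, ENNReal.coe_one, one_mul]

omit he in
lemma coe_sq_rpow_half (x : ℝ≥0) (p : ℝ) : ((x ^ 2 : ℝ≥0) : ℝ≥0∞) ^ (p / 2) = (x : ℝ≥0∞) ^ p := by
  rw [ENNReal.coe_pow, ENNReal.rpow_natCast_two_mul]

/-- If `C` has only the eigenvalue `σ i ^ 2` on the support of `u i`, then `‖a (u i)‖² + ‖b (u i)‖²
= σ i ^ 2`, and `a (u i)` already accounts for all of it. -/
lemma apply_eq_zero_of_weight (h : IsSchmidt a σ u v) (i : ι)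
    (hl : ∀ k, (((σ i) ^ 2 * ‖⟪u i, e k⟫_ℂ‖₊ ^ 2 * (l k)⁻¹ : ℝ≥0) : ℝ≥0∞) ≠ 0 → l k = σ i ^ 2) :
    b (u i) = 0 := by
  have h2 : ‖u i‖ₑ = 1 := by rw [← ofReal_norm, h.left.1 i, ENNReal.ofReal_one]
  have h1 : ∑' k, (l k : ℝ≥0∞) * ‖⟪e k, u i⟫_ℂ‖ₑ ^ 2 = (σ i : ℝ≥0∞) ^ 2 := by
    have h3 : ∀ k, (l k : ℝ≥0∞) * ‖⟪e k, u i⟫_ℂ‖ₑ ^ 2 =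
        (σ i : ℝ≥0∞) ^ 2 * ‖⟪e k, u i⟫_ℂ‖ₑ ^ 2 := by
      intro k
      by_cases h0 : ⟪e k, u i⟫_ℂ = 0
      · simp [h0]
      · have h0' : ⟪u i, e k⟫_ℂ ≠ 0 := fun h => h0 (inner_eq_zero_symm.1 h)
        have hlk : l k ≠ 0 := fun hk => h0' (inner_eq_zero_of_gram_eq_zero he h hk i)
        rw [hl k (by simp [h0', hlk, (h.pos i).ne']), ENNReal.coe_pow]
    simp_rw [h3, ENNReal.tsum_mul_left, e.tsum_enorm_inner_sq, h2]
    simp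
  have h4 : ‖a (u i)‖ₑ ^ 2 = (σ i : ℝ≥0∞) ^ 2 := by
    rw [h.apply_left, enorm_smul, h.right.isBessel.enorm_le_one i |>.antisymm ?_]
    · rw [enorm_eq_nnnorm]; simp
    · rw [← ofReal_norm, h.right.1 i, ENNReal.ofReal_one]
  rw [tsum_gram he, h4] at h1
  have h5 := (ENNReal.add_right_inj (by simp)).1 (h1.trans (add_zero _).symm)
  simpa using h5

/-- Jensen with exponent `p / 2`: `σ i ^ 2` is the weighted sum of the `l k`. For `p ≠ 2` the power
is strictly convex, so equality makes `l k` constant on the support of the weights. -/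
lemma gram_le_of_two_le (h : IsSchmidt a σ u v) {p : ℝ} (hp : 2 ≤ p) :
    (∑' i, (σ i : ℝ≥0∞) ^ p ≤
      ∑' k, ‖a (e k)‖ₑ ^ 2 * ((l k)⁻¹ : ℝ≥0) * (l k : ℝ≥0∞) ^ (p / 2)) ∧
    (p ≠ 2 → ∑' i, (σ i : ℝ≥0∞) ^ p ≠ ∞ → ∑' i, (σ i : ℝ≥0∞) ^ p =
      ∑' k, ‖a (e k)‖ₑ ^ 2 * ((l k)⁻¹ : ℝ≥0) * (l k : ℝ≥0∞) ^ (p / 2) → ∀ i, b (u i) = 0) := by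
  have hJ := fun i => rpow_le_tsum_mul_rpow (s := σ i ^ 2) (q := p / 2) (by linarith)
    (sum_weight_le_one he h i) (tsum_weight_mul he h i).ge
  simp only [coe_sq_rpow_half] at hJ
  rw [← tsum_tsum_weight_mul_rpow h]
  refine ⟨ENNReal.tsum_le_tsum fun i => (hJ i).1, fun hp2 hfin heq i => ?_⟩
  have h1 := ENNReal.eq_of_tsum_le_tsum (fun i => (hJ i).1) heq.ge hfin i
  exact apply_eq_zero_of_weight he h i (((hJ i).2 h1).2
    (by linarith [lt_of_le_of_ne hp hp2.symm]) (pow_ne_zero 2 (h.pos i).ne'))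

lemma le_gram_of_le_two (h : IsSchmidt a σ u v) {p : ℝ} (hp0 : 0 < p) (hp : p ≤ 2) :
    (∑' k, ‖a (e k)‖ₑ ^ 2 * ((l k)⁻¹ : ℝ≥0) * (l k : ℝ≥0∞) ^ (p / 2) ≤
      ∑' i, (σ i : ℝ≥0∞) ^ p) ∧
    (p ≠ 2 → ∑' i, (σ i : ℝ≥0∞) ^ p ≠ ∞ → ∑' i, (σ i : ℝ≥0∞) ^ p =
      ∑' k, ‖a (e k)‖ₑ ^ 2 * ((l k)⁻¹ : ℝ≥0) * (l k : ℝ≥0∞) ^ (p / 2) → ∀ i, b (u i) = 0) := by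
  have hJ := fun i => tsum_mul_rpow_le_rpow (s := σ i ^ 2) (q := p / 2) (by linarith)
    (by linarith) (sum_weight_le_one he h i) (tsum_weight_mul he h i)
  simp only [coe_sq_rpow_half] at hJ
  rw [← tsum_tsum_weight_mul_rpow h]
  refine ⟨ENNReal.tsum_le_tsum fun i => (hJ i).1, fun hp2 hfin heq i => ?_⟩
  have h1 := ENNReal.eq_of_tsum_le_tsum (fun i => (hJ i).1) heq.le (by rwa [← heq]) i
  exact apply_eq_zero_of_weight he h i ((hJ i).2 h1.symm
    (by linarith [lt_of_le_of_ne hp hp2]) (pow_ne_zero 2 (h.pos i).ne'))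

/-- The parallelogram law written as a mean over `Bool` with weights `1/2`, the form required by
Jensen's inequality. -/
lemma parallelogram (k : κ) :
    (∑' j : Bool, (2⁻¹ : ℝ≥0∞) * ((cond j (‖(a + b) (e k)‖₊ ^ 2) (‖(a - b) (e k)‖₊ ^ 2) : ℝ≥0) :
      ℝ≥0∞)) = l k := by
  rw [tsum_bool, ← enorm_sq_add_enorm_sq he]
  simp only [cond_false, cond_true, enorm_eq_nnnorm]
  have h1 : (((‖(a - b) (e k)‖₊ ^ 2 : ℝ≥0) : ℝ≥0∞) + ((‖(a + b) (e k)‖₊ ^ 2 : ℝ≥0) : ℝ≥0∞)) =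
      2 * ((‖a (e k)‖₊ : ℝ≥0∞) ^ 2 + (‖b (e k)‖₊ : ℝ≥0∞) ^ 2) := by
    norm_cast
    rw [← NNReal.coe_inj]
    push_cast
    have := parallelogram_law_with_norm ℂ (a (e k)) (b (e k))
    simp only [Pi.add_apply, Pi.sub_apply]
    linarith
  rw [← mul_add, h1, ← mul_assoc, ENNReal.inv_mul_cancel two_ne_zero ENNReal.ofNat_ne_top, one_mul]

lemma two_mul_rpow_gram_le {p : ℝ} (hp : 2 ≤ p) (k : κ) :
    2 * (l k : ℝ≥0∞) ^ (p / 2) ≤ ‖(a + b) (e k)‖ₑ ^ p + ‖(a - b) (e k)‖ₑ ^ p := by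
  have h := (rpow_le_tsum_mul_rpow (q := p / 2) (w := fun _ : Bool => 2⁻¹) (by linarith)
    (by rw [tsum_bool, ENNReal.inv_two_add_inv_two]) (parallelogram he k).ge).1
  rw [tsum_bool] at h
  simp only [cond_false, cond_true, coe_sq_rpow_half] at h
  rw [← mul_add, ← ENNReal.div_eq_inv_mul, ENNReal.le_div_iff_mul_le (by simp) (by simp)] at h
  rw [mul_comm, add_comm]
  exact h

lemma le_two_mul_rpow_gram {p : ℝ} (hp0 : 0 < p) (hp : p ≤ 2) (k : κ) :
    ‖(a + b) (e k)‖ₑ ^ p + ‖(a - b) (e k)‖ₑ ^ p ≤ 2 * (l k : ℝ≥0∞) ^ (p / 2) := by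
  have h := (tsum_mul_rpow_le_rpow (q := p / 2) (w := fun _ : Bool => 2⁻¹) (by linarith)
    (by linarith) (by rw [tsum_bool, ENNReal.inv_two_add_inv_two]) (parallelogram he k)).1
  rw [tsum_bool] at h
  simp only [cond_false, cond_true, coe_sq_rpow_half] at h
  rw [← mul_add, ← ENNReal.div_eq_inv_mul, ENNReal.div_le_iff (by simp) (by simp)] at h
  rw [mul_comm 2, add_comm]
  exact h

omit he

/-- The equality case of the Clarkson–McCarthy inequalities. -/
theorem clarkson_eq {ι' ι₁ ι₂ : Type*} {σ' : ι' → ℝ≥0} {σ₁ : ι₁ → ℝ≥0} {σ₂ : ι₂ → ℝ≥0}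
    {u' v' : ι' → H} {u₁ v₁ : ι₁ → H} {u₂ v₂ : ι₂ → H}
    (hC : IsCompactOperator (star a * a + star b * b)) (h : IsSchmidt a σ u v)
    (h' : IsSchmidt b σ' u' v') (h₁ : IsSchmidt (a + b) σ₁ u₁ v₁) (h₂ : IsSchmidt (a - b) σ₂ u₂ v₂)
    {p : ℝ} (hp0 : 0 < p) (hp : p ≠ 2) (hfin : ∑' i, (σ i : ℝ≥0∞) ^ p ≠ ∞)
    (hfin' : ∑' i, (σ' i : ℝ≥0∞) ^ p ≠ ∞)
    (heq : ∑' i, (σ₁ i : ℝ≥0∞) ^ p + ∑' i, (σ₂ i : ℝ≥0∞) ^ p =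
      2 * (∑' i, (σ i : ℝ≥0∞) ^ p + ∑' i, (σ' i : ℝ≥0∞) ^ p)) (i : ι) : b (u i) = 0 := by
  obtain ⟨κ, e, l, he⟩ := exists_gram_eigenbasis hC
  have he' : ∀ k, (star b * b + star a * a) (e k) = ((l k : ℝ) : ℂ) • e k := fun k => by
    rw [add_comm]; exact he k
  have hsplit := tsum_gram_rpow he (q := p / 2) (by linarith)
  rcases le_total 2 p with hp2 | hp2
  · have hA := gram_le_of_two_le he h hp2
    have hB := gram_le_of_two_le he' h' hp2
    refine hA.2 hp hfin (le_antisymm hA.1 ?_) i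
    -- This closes the chain of inequalities through `tr C ^ (p / 2)`, so every link is an equality.
    have hup : 2 * ∑' k, (l k : ℝ≥0∞) ^ (p / 2) ≤
        2 * (∑' i, (σ i : ℝ≥0∞) ^ p + ∑' i, (σ' i : ℝ≥0∞) ^ p) := by
      rw [← heq, ← ENNReal.tsum_mul_left]
      refine (ENNReal.tsum_le_tsum (two_mul_rpow_gram_le he hp2)).trans ?_
      rw [ENNReal.tsum_add]
      gcongr
      · exact h₁.tsum_enorm_rpow_le_tsum_rpow e hp2
      · exact h₂.tsum_enorm_rpow_le_tsum_rpow e hp2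
    rw [ENNReal.mul_le_mul_iff_right two_ne_zero ENNReal.ofNat_ne_top, ← hsplit] at hup
    exact (ENNReal.add_le_add_iff_right hfin').1
      ((add_le_add le_rfl hB.1).trans hup)
  · have hA := le_gram_of_le_two he h hp0 hp2
    have hB := le_gram_of_le_two he' h' hp0 hp2
    refine hA.2 hp hfin (le_antisymm ?_ hA.1) i
    have hup : 2 * (∑' i, (σ i : ℝ≥0∞) ^ p + ∑' i, (σ' i : ℝ≥0∞) ^ p) ≤
        2 * ∑' k, (l k : ℝ≥0∞) ^ (p / 2) := by
      rw [← heq, ← ENNReal.tsum_mul_left]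
      refine le_trans ?_ (ENNReal.tsum_le_tsum (le_two_mul_rpow_gram he hp0 hp2))
      rw [ENNReal.tsum_add]
      gcongr
      · exact h₁.tsum_rpow_le_tsum_enorm_rpow e hp0 hp2
      · exact h₂.tsum_rpow_le_tsum_enorm_rpow e hp0 hp2
    rw [ENNReal.mul_le_mul_iff_right two_ne_zero ENNReal.ofNat_ne_top, ← hsplit] at hup
    exact (ENNReal.add_le_add_iff_right hfin').1
      (hup.trans (add_le_add le_rfl hB.1))

lemma IsSchmidt.mul_eq_zero (h : IsSchmidt a σ u v) (hb : ∀ i, b (v i) = 0) : b * a = 0 := by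
  ext x
  refine ext_inner_left ℂ fun y => ?_
  rw [mul_apply_eq_comp, ← ContinuousLinearMap.adjoint_inner_left]
  refine (h.hasSum x _).unique ?_
  simp [ContinuousLinearMap.adjoint_inner_left, hb]

theorem schattenSum_add_of_orthogonal {a b : H →L[ℂ] H} (ha : IsCompactOperator a)
    (hb : IsCompactOperator b) {p : ℝ} (hp : 1 ≤ p) (hab : OpOrthogonal a b) :
    schattenSum p (a + b) = schattenSum p a + schattenSum p b := by
  obtain ⟨ι, σ, u, v, h, hσ⟩ := exists_isSchmidt ha
  obtain ⟨ι', σ', u', v', h', hσ'⟩ := exists_isSchmidt hb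
  rw [(h.add h' hab).schattenSum_eq (ha.add hb) hp, hσ p (by linarith), hσ' p (by linarith),
    Summable.tsum_sum ENNReal.summable ENNReal.summable]
  rfl

theorem schattenSum_smul {a : H →L[ℂ] H} (ha : IsCompactOperator a) {p : ℝ} (hp : 1 ≤ p) {c : ℂ}
    (hc : c ≠ 0) : schattenSum p (c • a) = ‖c‖ₑ ^ p * schattenSum p a := by
  obtain ⟨ι, σ, u, v, h, hσ⟩ := exists_isSchmidt ha
  rw [(h.smul hc).schattenSum_eq (ha.smul c) hp, hσ p (by linarith), ← ENNReal.tsum_mul_left]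
  refine tsum_congr fun i => ?_
  rw [ENNReal.coe_mul, ENNReal.mul_rpow_of_nonneg _ _ (by linarith)]
  rfl

theorem schattenSum_neg {a : H →L[ℂ] H} (ha : IsCompactOperator a) {p : ℝ} (hp : 1 ≤ p) :
    schattenSum p (-a) = schattenSum p a := by
  have := schattenSum_smul ha hp (c := -1) (by simp)
  simpa using this

/-- Orthogonality is the equality case of the Clarkson–McCarthy inequalities. -/
theorem orthogonal_of_clarkson_eq {a b : H →L[ℂ] H} (ha : IsCompactOperator a)
    (hb : IsCompactOperator b) {p : ℝ} (hp : 1 ≤ p) (hp2 : p ≠ 2) (hfa : schattenSum p a ≠ ∞)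
    (hfb : schattenSum p b ≠ ∞)
    (heq : schattenSum p (a + b) + schattenSum p (a - b) =
      2 * (schattenSum p a + schattenSum p b)) : OpOrthogonal a b := by
  obtain ⟨ι, σ, u, v, h, hσ⟩ := exists_isSchmidt ha
  obtain ⟨ι', σ', u', v', h', hσ'⟩ := exists_isSchmidt hb
  obtain ⟨ι₁, σ₁, u₁, v₁, h₁, hσ₁⟩ := exists_isSchmidt (a := a + b) (ha.add hb)
  obtain ⟨ι₂, σ₂, u₂, v₂, h₂, hσ₂⟩ := exists_isSchmidt (a := a - b) (ha.sub hb)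
  have hp0 : 0 < p := by linarith
  rw [hσ p hp0, hσ' p hp0, hσ₁ p hp0, hσ₂ p hp0] at heq
  rw [hσ p hp0] at hfa
  rw [hσ' p hp0] at hfb
  have hC₀ : IsCompactOperator (star a * a + star b * b) :=
    (ha.clm_comp (star a)).add (hb.clm_comp (star b))
  have h1 : ∀ i, b (u i) = 0 := clarkson_eq hC₀ h h' h₁ h₂ hp0 hp2 hfa hfb heq
  -- The first pass gives `b a* = 0`; the same argument for the adjoints gives `b* a = 0`.
  have hC : IsCompactOperator (star (star a) * star a + star (star b) * star b) := by
    simp only [star_star]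
    exact (ha.comp_clm (star a)).add (hb.comp_clm (star b))
  have h₁' : IsSchmidt (star a + star b) σ₁ v₁ u₁ := by
    rw [← star_add]
    exact h₁.adjoint
  have h₂' : IsSchmidt (star a - star b) σ₂ v₂ u₂ := by
    rw [← star_sub]
    exact h₂.adjoint
  have h2 : ∀ i, star b (v i) = 0 := clarkson_eq hC h.adjoint h'.adjoint h₁' h₂' hp0 hp2 hfa hfb heq
  refine ⟨?_, h.mul_eq_zero h2⟩
  rw [← star_inj, star_mul, star_star, star_zero]
  exact h.adjoint.mul_eq_zero h1

end Clarkson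

/-! ### Midpoints on the sphere and strict convexity for `1 < p`. -/

section Rotund

variable {H : Type*} [NormedAddCommGroup H] [InnerProductSpace ℂ H] [CompleteSpace H]
  {ι ι' κ : Type*}

/-- The partial isometry `∑ₖ ⟪fₖ, ·⟫ eₖ`. -/
lemma exists_contraction_of_orthonormal {e f : κ → H} (he : Orthonormal ℂ e)
    (hf : Orthonormal ℂ f) :
    ∃ U : H →L[ℂ] H, ‖U‖ ≤ 1 ∧ ∀ x, HasSum (fun k => ⟪f k, x⟫_ℂ • e k) (U x) := by
  classical
  let E := he.orthogonalFamily.linearIsometry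
  let F := hf.orthogonalFamily.linearIsometry
  have hF : ∀ x k, (F.toContinuousLinearMap.adjoint x) k = ⟪f k, x⟫_ℂ := by
    intro x k
    have h1 := lp.inner_single_left (𝕜 := ℂ) k (1 : ℂ) (F.toContinuousLinearMap.adjoint x)
    rw [ContinuousLinearMap.adjoint_inner_right] at h1
    simp only [LinearIsometry.coe_toContinuousLinearMap] at h1
    rw [OrthogonalFamily.linearIsometry_apply_single] at h1
    simpa using h1.symm
  refine ⟨E.toContinuousLinearMap ∘L F.toContinuousLinearMap.adjoint, ?_, fun x => ?_⟩
  · refine (ContinuousLinearMap.opNorm_comp_le _ _).trans ?_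
    rw [LinearIsometryEquiv.norm_map]
    exact mul_le_one₀ (LinearIsometry.norm_toContinuousLinearMap_le _) (norm_nonneg _)
      (LinearIsometry.norm_toContinuousLinearMap_le _)
  · have := he.orthogonalFamily.hasSum_linearIsometry (F.toContinuousLinearMap.adjoint x)
    simp only [hF, LinearIsometry.toSpanSingleton_apply] at this
    exact this

lemma eq_of_re_inner_eq {x y : H} (hxy : (⟪x, y⟫_ℂ).re = ‖x‖ ^ 2) (hy : ‖y‖ ≤ ‖x‖) : y = x := by
  have h1 := norm_sub_sq (𝕜 := ℂ) x y
  rw [RCLike.re_eq_complex_re, hxy] at h1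
  have h2 : ‖y‖ ^ 2 ≤ ‖x‖ ^ 2 := pow_le_pow_left₀ (norm_nonneg _) hy 2
  have h3 : ‖x - y‖ ^ 2 = 0 := le_antisymm (by linarith) (by positivity)
  have h4 : x - y = 0 := by simpa using h3
  exact (sub_eq_zero.1 h4).symm

/-- Equality in Bessel's inequality gives the Fourier expansion. -/
lemma Orthonormal.hasSum_of_tsum_eq {f : κ → H} (hf : Orthonormal ℂ f) {x : H} (hx : ‖x‖ = 1)
    (h : ∑' k, ‖⟪f k, x⟫_ℂ‖ₑ ^ 2 = 1) : HasSum (fun k => ⟪f k, x⟫_ℂ • f k) x := by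
  -- `P` is the projection onto the closed span of `f`. Here `⟪x, P x⟫ = 1` with `‖P x‖ ≤ 1`, so `P
  -- x = x`.
  obtain ⟨P, hP, hsum⟩ := exists_contraction_of_orthonormal hf hf
  have h1 := (hsum x).mapL (innerSL ℂ x)
  simp only [innerSL_apply_apply, inner_smul_right] at h1
  have h2 : ∀ k, ⟪f k, x⟫_ℂ * ⟪x, f k⟫_ℂ = ((‖⟪f k, x⟫_ℂ‖ ^ 2 : ℝ) : ℂ) := fun k => by
    rw [← inner_conj_symm x, Complex.mul_conj']
    push_cast
    rfl
  simp_rw [h2] at h1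
  have h3 : HasSum (fun k => ‖⟪f k, x⟫_ℂ‖ ^ 2) 1 := by
    have h4 := (hf.inner_products_summable x).hasSum
    convert! h4 using 1
    simp_rw [enorm_sq_eq_ofReal] at h
    rw [← ENNReal.ofReal_tsum_of_nonneg (fun _ => by positivity)
      (hf.inner_products_summable x)] at h
    exact (ENNReal.ofReal_eq_one.1 h).symm
  have h5 := h1.unique (Complex.hasSum_ofReal.2 h3)
  have h6 : P x = x := by
    refine eq_of_re_inner_eq (by rw [h5, hx]; simp) ?_
    exact (P.le_of_opNorm_le hP x).trans_eq (one_mul _)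
  simpa [h6] using hsum x

lemma star_apply_of_contraction {U : H →L[ℂ] H} (hU : ‖U‖ ≤ 1) {x y : H} (hx : ‖x‖ = 1)
    (hy : ‖y‖ = 1) (h : U x = y) : star U y = x := by
  refine eq_of_re_inner_eq ?_ ?_
  · rw [ContinuousLinearMap.star_eq_adjoint, ContinuousLinearMap.adjoint_inner_right, h,
      inner_self_eq_norm_sq_to_K, hy, hx]
    simp
  · rw [hx]
    have h1 : ‖star U‖ ≤ 1 := by rwa [norm_star]
    refine ((star U).le_of_opNorm_le h1 y).trans_eq ?_
    rw [hy, one_mul]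

/-- The kernel `K` of `A - B` is closed and contains the `u i`; the second hypothesis puts `Kᗮ`
inside `K`, so `Kᗮ` vanishes. -/
lemma eq_of_forall_orthogonal {A B : H →L[ℂ] H} {u : ι → H} (h : ∀ i, A (u i) = B (u i))
    (h' : ∀ w, (∀ i, ⟪u i, w⟫_ℂ = 0) → A w = B w) : A = B := by
  set K := LinearMap.ker ((A - B : H →L[ℂ] H) : H →ₗ[ℂ] H) with hK
  have hcl : IsClosed (K : Set H) := (A - B).isClosed_ker
  have : CompleteSpace K := hcl.completeSpace_coe
  have hmem : ∀ w, w ∈ K ↔ A w = B w := fun w => by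
    simp [hK, sub_eq_zero]
  have hle : Kᗮ ≤ K := fun w hw => (hmem w).2 (h' w fun i => hw _ ((hmem _).2 (h i)))
  have hbot : Kᗮ = ⊥ := by
    rw [eq_bot_iff, ← K.inf_orthogonal_eq_bot]
    exact le_inf hle le_rfl
  have htop : K = ⊤ := (Submodule.orthogonal_eq_bot_iff).1 hbot
  ext w
  exact (hmem w).1 (htop ▸ Submodule.mem_top)

lemma apply_eq_of_forall_orthogonal {A B : H →L[ℂ] H} {u : ι → H} (h : ∀ i, A (u i) = B (u i))
    {x : H} (hx : ∀ w, (∀ i, ⟪u i, w⟫_ℂ = 0) → ⟪w, x⟫_ℂ = 0) : A x = B x := by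
  set K := LinearMap.ker ((A - B : H →L[ℂ] H) : H →ₗ[ℂ] H) with hK
  have hcl : IsClosed (K : Set H) := (A - B).isClosed_ker
  have : CompleteSpace K := hcl.completeSpace_coe
  have hmem : ∀ w, w ∈ K ↔ A w = B w := fun w => by
    simp [hK, sub_eq_zero]
  have hxK : x ∈ Kᗮᗮ := fun w hw => hx w fun i => hw _ ((hmem _).2 (h i))
  rw [Submodule.orthogonal_orthogonal] at hxK
  exact (hmem x).1 hxK

/-- If `x`, `y` and their midpoint are unit vectors, then the Schmidt system of the midpoint
diagonalizes `x` and `y` with nonnegative coefficients. -/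
lemma exists_schmidt_midpoint.{w} {H : Type w} [NormedAddCommGroup H] [InnerProductSpace ℂ H]
    [CompleteSpace H] {x y : H →L[ℂ] H} (hx : IsCompactOperator x)
    (hy : IsCompactOperator y) {p : ℝ} (hp : 1 ≤ p) (hSx : schattenSum p x = 1)
    (hSy : schattenSum p y = 1) (hxy : schattenSum p ((2⁻¹ : ℂ) • (x + y)) = 1) :
    ∃ (κ : Type w) (ζ : κ → ℝ≥0) (e f : κ → H), IsSchmidt ((2⁻¹ : ℂ) • (x + y)) ζ e f ∧
      ∃ X Y : κ → ℝ≥0, (∀ k, ⟪f k, x (e k)⟫_ℂ = ((X k : ℝ) : ℂ)) ∧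
        (∀ k, ⟪f k, y (e k)⟫_ℂ = ((Y k : ℝ) : ℂ)) ∧
        1 ≤ ∑' k, (X k : ℝ≥0∞) ^ p ∧ 1 ≤ ∑' k, (Y k : ℝ≥0∞) ^ p ∧
        (1 < p → ∀ k, X k = ζ k ∧ Y k = ζ k) := by
  have hp0 : 0 < p := by linarith
  have hz : IsCompactOperator ((2⁻¹ : ℂ) • (x + y)) := (hx.add hy).smul (2⁻¹ : ℂ)
  obtain ⟨κ, ζ, e, f, h, hζ⟩ := exists_isSchmidt hz
  obtain ⟨ι, σ, u, v, h₁, hσ⟩ := exists_isSchmidt hx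
  obtain ⟨ι', σ', u', v', h₂, hσ'⟩ := exists_isSchmidt hy
  have hX : ∑' k, ‖⟪f k, x (e k)⟫_ℂ‖ₑ ^ p ≤ 1 := by
    rw [← hSx, hσ p hp0]
    exact h₁.tsum_enorm_inner_rpow_le h.left.isBessel h.right.isBessel hp
  have hY : ∑' k, ‖⟪f k, y (e k)⟫_ℂ‖ₑ ^ p ≤ 1 := by
    rw [← hSy, hσ' p hp0]
    exact h₂.tsum_enorm_inner_rpow_le h.left.isBessel h.right.isBessel hp
  have hZ : ∑' k, (ζ k : ℝ≥0∞) ^ p = 1 := by rw [← hζ p hp0, hxy]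
  have hval : ∀ k, ((ζ k : ℝ) : ℂ) = 2⁻¹ * (⟪f k, x (e k)⟫_ℂ + ⟪f k, y (e k)⟫_ℂ) := by
    intro k
    have h1 := h.inner_right_apply k (e k)
    rw [inner_self_eq_norm_sq_to_K, h.left.1 k, smul_apply, inner_smul_right, add_apply,
      inner_add_right] at h1
    rw [h1]
    simp
  have hle : ∀ k, (ζ k : ℝ≥0∞) ≤ ∑' j : Bool, (2⁻¹ : ℝ≥0∞) *
      ((cond j ‖⟪f k, x (e k)⟫_ℂ‖₊ ‖⟪f k, y (e k)⟫_ℂ‖₊ : ℝ≥0) : ℝ≥0∞) := by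
    intro k
    have h1 : (ζ k : ℝ≥0∞) = ‖((ζ k : ℝ) : ℂ)‖ₑ := by rw [enorm_eq_nnnorm]; simp
    rw [h1, hval, tsum_bool, enorm_mul, ← mul_add, cond_false, cond_true]
    have h2 : ‖(2⁻¹ : ℂ)‖ₑ = 2⁻¹ := by
      rw [← ofReal_norm, norm_inv, RCLike.norm_ofNat, ENNReal.ofReal_inv_of_pos two_pos]
      simp
    rw [h2]
    gcongr
    rw [add_comm]
    exact enorm_add_le _ _
  have hJ := fun k => rpow_le_tsum_mul_rpow (s := ζ k) (w := fun _ : Bool => 2⁻¹) hp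
    (by rw [tsum_bool, ENNReal.inv_two_add_inv_two]) (hle k)
  simp only [tsum_bool, cond_false, cond_true, ← mul_add, Bool.forall_bool] at hJ
  have hXY : ∑' k, 2⁻¹ * ((‖⟪f k, y (e k)⟫_ℂ‖₊ : ℝ≥0∞) ^ p + (‖⟪f k, x (e k)⟫_ℂ‖₊ : ℝ≥0∞) ^ p) ≤
      ∑' k, (ζ k : ℝ≥0∞) ^ p := by
    rw [hZ, ENNReal.tsum_mul_left, ENNReal.tsum_add]
    exact ENNReal.half_mul_add_le_one hY hX
  -- The sums on both sides are squeezed to 1, so the Jensen step is an equality for each `k`. The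
  -- two diagonal entries then have moduli and real parts with the same sum `2 ζ k`, hence are
  -- nonnegative.
  have hterm := ENNReal.eq_of_tsum_le_tsum (fun k => (hJ k).1) hXY (by rw [hZ]; simp)
  have hreal : ∀ k, (‖⟪f k, x (e k)⟫_ℂ‖ + ‖⟪f k, y (e k)⟫_ℂ‖) = 2 * ζ k := by
    intro k
    have h1 := ((hJ k).2 (hterm k)).1
    rw [← ENNReal.div_eq_inv_mul, ← ENNReal.coe_add, ← ENNReal.coe_ofNat,
      ← ENNReal.coe_div two_ne_zero, ENNReal.coe_inj, div_eq_iff two_ne_zero] at h1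
    have h2 := congrArg ((↑) : ℝ≥0 → ℝ) h1
    push_cast at h2
    linarith
  have hre : ∀ k, (⟪f k, x (e k)⟫_ℂ).re + (⟪f k, y (e k)⟫_ℂ).re = 2 * ζ k := by
    intro k
    have h1 : 2 * ((ζ k : ℝ) : ℂ) = ⟪f k, x (e k)⟫_ℂ + ⟪f k, y (e k)⟫_ℂ := by
      rw [hval]; ring
    have h2 := congrArg Complex.re h1
    rw [Complex.add_re] at h2
    rw [← h2]
    simp
  have hpos : ∀ z : ℂ, z.re = ‖z‖ → z = ((‖z‖₊ : ℝ) : ℂ) := fun z hz => by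
    have := Complex.re_eq_norm.1 hz
    exact Complex.eq_coe_norm_of_nonneg this
  have hsum2 : 2 ≤ ∑' k, (‖⟪f k, y (e k)⟫_ℂ‖₊ : ℝ≥0∞) ^ p +
      ∑' k, (‖⟪f k, x (e k)⟫_ℂ‖₊ : ℝ≥0∞) ^ p := by
    have h1 : ∑' k, 2⁻¹ * ((‖⟪f k, y (e k)⟫_ℂ‖₊ : ℝ≥0∞) ^ p +
        (‖⟪f k, x (e k)⟫_ℂ‖₊ : ℝ≥0∞) ^ p) = 1 := by
      rw [← hZ]
      exact tsum_congr fun k => (hterm k).symm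
    rw [ENNReal.tsum_mul_left, ENNReal.tsum_add] at h1
    have h2 := congrArg (2 * ·) h1
    simp only [← mul_assoc, ENNReal.mul_inv_cancel two_ne_zero ENNReal.ofNat_ne_top, one_mul,
      mul_one] at h2
    exact h2.ge
  refine ⟨κ, ζ, e, f, h, fun k => ‖⟪f k, x (e k)⟫_ℂ‖₊, fun k => ‖⟪f k, y (e k)⟫_ℂ‖₊, ?_, ?_, ?_,
    ?_, ?_⟩
  · intro k
    refine hpos _ (le_antisymm (Complex.re_le_norm _) ?_)
    linarith [hreal k, hre k, Complex.re_le_norm ⟪f k, y (e k)⟫_ℂ]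
  · intro k
    refine hpos _ (le_antisymm (Complex.re_le_norm _) ?_)
    linarith [hreal k, hre k, Complex.re_le_norm ⟪f k, x (e k)⟫_ℂ]
  · rw [← one_add_one_eq_two] at hsum2
    exact (ENNReal.add_le_add_iff_left ENNReal.one_ne_top).1
      (hsum2.trans (add_le_add hY le_rfl))
  · rw [← one_add_one_eq_two] at hsum2
    exact (ENNReal.add_le_add_iff_right ENNReal.one_ne_top).1
      (hsum2.trans (add_le_add le_rfl hX))
  · intro hp1 k
    have := ((hJ k).2 (hterm k)).2 hp1 (h.pos k).ne'
    exact ⟨this.2 (by simp), this.1 (by simp)⟩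

/-- Equality in the diagonal inequality gives `u i` and `v i` the same coefficients in `e` and `f`,
supported where `ζ k = σ i`; hence `z` maps `u i` to `σ i • v i`. -/
lemma IsSchmidt.apply_eq_of_diagonal {x z : H →L[ℂ] H} {σ : ι → ℝ≥0} {u v : ι → H} {ζ : κ → ℝ≥0}
    {e f : κ → H} (hx : IsSchmidt x σ u v) (hz : IsSchmidt z ζ e f) {p : ℝ} (hp : 1 < p)
    (hσ : ∑' i, (σ i : ℝ≥0∞) ^ p = 1) (hd : ∀ k, ⟪f k, x (e k)⟫_ℂ = ((ζ k : ℝ) : ℂ))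
    (hζ : 1 ≤ ∑' k, (ζ k : ℝ≥0∞) ^ p) (i : ι) : z (u i) = x (u i) := by
  obtain ⟨h1, h2, h3⟩ := hx.eq_of_tsum_inner_rpow_eq hz.left.isBessel hz.right.isBessel hp.le
    (by simp [hσ]) hd (by rwa [hσ]) i
  simp_rw [h1] at h2
  have h4 := hz.right.hasSum_of_tsum_eq (hx.right.1 i) h2
  refine ext_inner_left ℂ fun g => ?_
  refine (hz.hasSum (u i) g).unique ?_
  rw [hx.apply_left, inner_smul_right]
  have h5 := (h4.mapL (innerSL ℂ g)).mul_left (((σ i : ℝ) : ℂ))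
  simp only [innerSL_apply_apply, inner_smul_right] at h5
  refine h5.congr_fun fun k => ?_
  rw [h1]
  by_cases h0 : ⟪f k, v i⟫_ℂ = 0
  · simp [h0]
  · rw [h3 hp k (hz.pos k).ne' (by rwa [h1])]

/-- Strict convexity of the Schatten norms, `1 < p`. -/
theorem eq_of_schattenSum_midpoint {x y : H →L[ℂ] H} (hx : IsCompactOperator x)
    (hy : IsCompactOperator y) {p : ℝ} (hp : 1 < p) (hSx : schattenSum p x = 1)
    (hSy : schattenSum p y = 1) (hxy : schattenSum p ((2⁻¹ : ℂ) • (x + y)) = 1) : x = y := by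
  have hp0 : 0 < p := by linarith
  obtain ⟨κ, ζ, e, f, h, X, Y, hX, hY, hSX, hSY, hXY⟩ :=
    exists_schmidt_midpoint hx hy hp.le hSx hSy hxy
  obtain ⟨ι, σ, u, v, h₁, hσ⟩ := exists_isSchmidt hx
  obtain ⟨ι', σ', u', v', h₂, hσ'⟩ := exists_isSchmidt hy
  simp only [(hXY hp _).1] at hX hSX
  simp only [(hXY hp _).2] at hY hSY
  have hux := h₁.apply_eq_of_diagonal h hp (by rw [← hσ p hp0, hSx]) hX hSX
  have huy := h₂.apply_eq_of_diagonal h hp (by rw [← hσ' p hp0, hSy]) hY hSY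
  have hmid : ∀ s t : H, (2⁻¹ : ℂ) • (s + t) = s → s = t := fun s t hst => by
    have h2 := congrArg ((2 : ℂ) • ·) hst
    simp only [smul_smul] at h2
    rw [mul_inv_cancel₀ two_ne_zero, one_smul, two_smul] at h2
    exact (add_left_cancel h2).symm
  refine eq_of_forall_orthogonal (u := Sum.elim u u') ?_ ?_
  · rintro (i | i)
    · exact hmid _ _ (by simpa using hux i)
    · exact (hmid _ _ (by simpa [add_comm] using huy i)).symm
  · intro w hw
    rw [h₁.apply_eq_zero fun i => hw (Sum.inl i), h₂.apply_eq_zero fun i => hw (Sum.inr i)]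

end Rotund

/-! ### The trace class: a metric description of additivity of the norm. -/

section TraceNorm

variable {H : Type*} [NormedAddCommGroup H] [InnerProductSpace ℂ H] [CompleteSpace H]
  {ι ι' κ : Type*}

lemma mem_schattenSphere_iff {a : H →L[ℂ] H} {p : ℝ} (hp : 1 ≤ p) :
    a ∈ schattenSphere p H ↔ IsCompactOperator a ∧ schattenSum p a = 1 := by
  have hp0 : 0 < 1 / p := by positivity
  have h1 : schattenNorm p a = 1 ↔ schattenSum p a = 1 := by
    rw [schattenNorm]
    constructor
    · intro h
      have := congrArg (· ^ p) h
      simpa [← ENNReal.rpow_mul, (by linarith : p ≠ 0)] using this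
    · intro h
      rw [h, ENNReal.one_rpow]
  constructor
  · rintro ⟨⟨h, -⟩, h2⟩
    exact ⟨h, h1.1 h2⟩
  · rintro ⟨h, h2⟩
    exact ⟨⟨h, by rw [h1.2 h2]; exact ENNReal.one_lt_top⟩, h1.2 h2⟩

theorem schattenSum_one_add_le {a b : H →L[ℂ] H} (ha : IsCompactOperator a)
    (hb : IsCompactOperator b) :
    schattenSum 1 (a + b) ≤ schattenSum 1 a + schattenSum 1 b := by
  obtain ⟨ι, σ, u, v, h, hσ⟩ := exists_isSchmidt ha
  obtain ⟨ι', σ', u', v', h', hσ'⟩ := exists_isSchmidt hb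
  obtain ⟨κ, ζ, e, f, hz, hζ⟩ := exists_isSchmidt (a := a + b) (ha.add hb)
  have h1 := h.tsum_enorm_inner_rpow_le hz.left.isBessel hz.right.isBessel le_rfl
  have h2 := h'.tsum_enorm_inner_rpow_le hz.left.isBessel hz.right.isBessel le_rfl
  rw [hσ 1 one_pos, hσ' 1 one_pos, hζ 1 one_pos]
  refine le_trans ?_ (add_le_add h1 h2)
  rw [← ENNReal.tsum_add]
  refine ENNReal.tsum_le_tsum fun k => ?_
  rw [← hz.enorm_inner_self k]
  simp only [ENNReal.rpow_one]
  rw [add_apply, inner_add_right]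
  exact enorm_add_le _ _

/-- If the trace norm is additive on `x`, `y`, one contraction inverts the polar parts of both. -/
lemma exists_contraction_of_midpoint {x y : H →L[ℂ] H} {σ : ι → ℝ≥0} {u v : ι → H}
    {σ' : ι' → ℝ≥0} {u' v' : ι' → H} (h₁ : IsSchmidt x σ u v) (h₂ : IsSchmidt y σ' u' v')
    (hx : IsCompactOperator x) (hy : IsCompactOperator y) (hSx : schattenSum 1 x = 1)
    (hSy : schattenSum 1 y = 1) (hxy : schattenSum 1 ((2⁻¹ : ℂ) • (x + y)) = 1) :
    ∃ U : H →L[ℂ] H, ‖U‖ ≤ 1 ∧ (∀ i, U (v i) = u i) ∧ ∀ i, U (v' i) = u' i := by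
  obtain ⟨κ, ζ, e, f, h, X, Y, hX, hY, hSX, hSY, -⟩ :=
    exists_schmidt_midpoint hx hy le_rfl hSx hSy hxy
  obtain ⟨U, hU, hsum⟩ := exists_contraction_of_orthonormal h.left h.right
  rw [h₁.schattenSum_eq hx le_rfl] at hSx
  rw [h₂.schattenSum_eq hy le_rfl] at hSy
  refine ⟨U, hU, fun i => ?_, fun i => ?_⟩
  · obtain ⟨h3, h4, -⟩ := h₁.eq_of_tsum_inner_rpow_eq h.left.isBessel h.right.isBessel le_rfl
      (by rw [hSx]; simp) hX (by rwa [hSx]) i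
    have h5 := h.left.hasSum_of_tsum_eq (h₁.left.1 i) h4
    simp_rw [h3] at h5
    exact (hsum (v i)).unique h5
  · obtain ⟨h3, h4, -⟩ := h₂.eq_of_tsum_inner_rpow_eq h.left.isBessel h.right.isBessel le_rfl
      (by rw [hSy]; simp) hY (by rwa [hSy]) i
    have h5 := h.left.hasSum_of_tsum_eq (h₂.left.1 i) h4
    simp_rw [h3] at h5
    exact (hsum (v' i)).unique h5

/-- Because `U` inverts the polar part, the number is `⟪x, U a x⟫ = ⟪x, |a| x⟫`, whose sum over a
basis is the trace norm. -/
lemma IsSchmidt.exists_diagonal {a : H →L[ℂ] H} {σ : ι → ℝ≥0} {u v : ι → H}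
    (h : IsSchmidt a σ u v) {U : H →L[ℂ] H} (hUv : ∀ i, U (v i) = u i) (x : H) :
    ∃ t : ℝ≥0, ⟪star U x, a x⟫_ℂ = ((t : ℝ) : ℂ) ∧
      (t : ℝ≥0∞) = ∑' i, (σ i : ℝ≥0∞) * ‖⟪u i, x⟫_ℂ‖ₑ ^ 2 := by
  have h1 := h.hasSum x (star U x)
  have h2 : ∀ i, ((σ i : ℝ) : ℂ) * (⟪u i, x⟫_ℂ * ⟪star U x, v i⟫_ℂ) =
      ((σ i * ‖⟪u i, x⟫_ℂ‖ ^ 2 : ℝ) : ℂ) := by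
    intro i
    rw [ContinuousLinearMap.star_eq_adjoint, ContinuousLinearMap.adjoint_inner_left, hUv,
      ← inner_conj_symm x (u i), Complex.mul_conj']
    push_cast
    rfl
  simp_rw [h2] at h1
  have h3 := Complex.hasSum_re h1
  simp only [Complex.ofReal_re] at h3
  have h4 : ⟪star U x, a x⟫_ℂ = (((⟪star U x, a x⟫_ℂ).re : ℝ) : ℂ) :=
    h1.unique (Complex.hasSum_ofReal.2 h3)
  have h5 : 0 ≤ (⟪star U x, a x⟫_ℂ).re := h3.nonneg fun i => by positivity
  refine ⟨(⟪star U x, a x⟫_ℂ).re.toNNReal, by rwa [Real.coe_toNNReal _ h5], ?_⟩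
  rw [ENNReal.ofNNReal_toNNReal, ← h3.tsum_eq,
    ENNReal.ofReal_tsum_of_nonneg (fun i => by positivity) h3.summable]
  refine tsum_congr fun i => ?_
  rw [ENNReal.ofReal_mul (by positivity), ENNReal.ofReal_coe_nnreal, enorm_sq_eq_ofReal]

lemma tsum_tsum_diagonal {u : ι → H} (hu : Orthonormal ℂ u) (e : HilbertBasis κ ℂ H)
    (σ : ι → ℝ≥0) :
    ∑' k, ∑' i, (σ i : ℝ≥0∞) * ‖⟪u i, e k⟫_ℂ‖ₑ ^ 2 = ∑' i, (σ i : ℝ≥0∞) ^ (1 : ℝ) := by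
  rw [ENNReal.tsum_comm]
  refine tsum_congr fun i => ?_
  have h2 : ‖u i‖ₑ = 1 := by rw [← ofReal_norm, hu.1 i, ENNReal.ofReal_one]
  simp_rw [ENNReal.tsum_mul_left, enorm_inner_symm (u i), e.tsum_enorm_inner_sq, h2]
  simp

/-- The trace norm is additive on operators whose polar parts are inverted by one contraction. -/
lemma schattenSum_one_add_of_contraction {a b : H →L[ℂ] H} {σ : ι → ℝ≥0} {u v : ι → H}
    {σ' : ι' → ℝ≥0} {u' v' : ι' → H} (h₁ : IsSchmidt a σ u v) (h₂ : IsSchmidt b σ' u' v')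
    (ha : IsCompactOperator a) (hb : IsCompactOperator b) {U : H →L[ℂ] H} (hU : ‖U‖ ≤ 1)
    (hUv : ∀ i, U (v i) = u i) (hUv' : ∀ i, U (v' i) = u' i) :
    schattenSum 1 (a + b) = schattenSum 1 a + schattenSum 1 b := by
  refine le_antisymm (schattenSum_one_add_le ha hb) ?_
  obtain ⟨w, e, -⟩ := exists_hilbertBasis ℂ H
  obtain ⟨κ, ζ, g, f, hz, hζ⟩ := exists_isSchmidt (a := a + b) (ha.add hb)
  -- This family need not be orthonormal, which is why the diagonal inequality is stated for Bessel
  -- families.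
  have hB : IsBessel fun k => star U (e k) := by
    intro x
    simp only [ContinuousLinearMap.star_eq_adjoint, ContinuousLinearMap.adjoint_inner_left]
    refine (e.orthonormal.isBessel (U x)).trans ?_
    gcongr
    rw [← ofReal_norm, ← ofReal_norm]
    exact ENNReal.ofReal_le_ofReal ((U.le_of_opNorm_le hU x).trans_eq (one_mul _))
  have h3 := hz.tsum_enorm_inner_rpow_le e.orthonormal.isBessel hB le_rfl
  rw [hζ 1 one_pos]
  refine le_trans ?_ h3
  rw [h₁.schattenSum_eq ha le_rfl, h₂.schattenSum_eq hb le_rfl, ← tsum_tsum_diagonal h₁.left e,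
    ← tsum_tsum_diagonal h₂.left e, ← ENNReal.tsum_add]
  refine ENNReal.tsum_le_tsum fun k => ?_
  obtain ⟨s, hs, hs'⟩ := h₁.exists_diagonal hUv (e k)
  obtain ⟨t, ht, ht'⟩ := h₂.exists_diagonal hUv' (e k)
  rw [← hs', ← ht', add_apply, inner_add_right, hs, ht, ENNReal.rpow_one, ← Complex.ofReal_add,
    ← NNReal.coe_add, enorm_eq_nnnorm, ← ENNReal.coe_add, Complex.nnnorm_real, NNReal.nnnorm_eq]

lemma schattenSum_one_half_smul {a : H →L[ℂ] H} (ha : IsCompactOperator a) :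
    schattenSum 1 ((2⁻¹ : ℂ) • a) = 2⁻¹ * schattenSum 1 a := by
  have h2 : ‖(2⁻¹ : ℂ)‖ₑ = 2⁻¹ := by
    rw [← ofReal_norm, norm_inv, RCLike.norm_ofNat, ENNReal.ofReal_inv_of_pos two_pos]
    simp
  rw [schattenSum_smul ha le_rfl (by simp), h2, ENNReal.rpow_one]

lemma half_smul_mem_schattenSphere {a : H →L[ℂ] H} (ha : IsCompactOperator a)
    (h : schattenSum 1 a = 2) : (2⁻¹ : ℂ) • a ∈ schattenSphere 1 H := by
  refine (mem_schattenSphere_iff le_rfl).2 ⟨ha.smul (2⁻¹ : ℂ), ?_⟩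
  rw [schattenSum_one_half_smul ha, h, ENNReal.inv_mul_cancel two_ne_zero ENNReal.ofNat_ne_top]

lemma OpOrthogonal.smul_smul {a b : H →L[ℂ] H} (h : OpOrthogonal a b) (s t : ℂ) :
    OpOrthogonal (s • a) (t • b) := by
  simp [OpOrthogonal, h.1, h.2, star_smul]

lemma schattenSum_one_of_two_halves {x y : H →L[ℂ] H} (hx : IsCompactOperator x)
    (hy : IsCompactOperator y) (hSx : schattenSum 1 x ≤ 2) (hSy : schattenSum 1 y ≤ 2)
    (h : schattenSum 1 ((2⁻¹ : ℂ) • (x + y)) = 2) : schattenSum 1 x = 2 ∧ schattenSum 1 y = 2 := by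
  rw [schattenSum_one_half_smul (hx.add hy), ← ENNReal.div_eq_inv_mul] at h
  have h1 : schattenSum 1 (x + y) = 2 + 2 := by
    rw [← ENNReal.div_mul_cancel (b := schattenSum 1 (x + y)) two_ne_zero ENNReal.ofNat_ne_top, h,
      mul_two]
  have h2 := h1.symm.trans_le (schattenSum_one_add_le hx hy)
  constructor
  · refine le_antisymm hSx ?_
    exact (ENNReal.add_le_add_iff_right ENNReal.ofNat_ne_top).1 (h2.trans (add_le_add le_rfl hSy))
  · refine le_antisymm hSy ?_
    exact (ENNReal.add_le_add_iff_left ENNReal.ofNat_ne_top).1 (h2.trans (add_le_add hSx le_rfl))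

lemma schattenSum_sub_le_two {a b : H →L[ℂ] H} (ha : a ∈ schattenSphere 1 H)
    (hb : b ∈ schattenSphere 1 H) : schattenSum 1 (a - b) ≤ 2 := by
  obtain ⟨ha, ha'⟩ := (mem_schattenSphere_iff le_rfl).1 ha
  obtain ⟨hb, hb'⟩ := (mem_schattenSphere_iff le_rfl).1 hb
  have h := schattenSum_one_add_le ha (b := -b) hb.neg
  rwa [schattenSum_neg hb le_rfl, ha', hb', one_add_one_eq_two, ← sub_eq_add_neg] at h

lemma neg_mem_schattenSphere {a : H →L[ℂ] H} {p : ℝ} (hp : 1 ≤ p) (ha : a ∈ schattenSphere p H) :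
    -a ∈ schattenSphere p H := by
  obtain ⟨ha, ha'⟩ := (mem_schattenSphere_iff hp).1 ha
  exact (mem_schattenSphere_iff hp).2 ⟨ha.neg, by rw [schattenSum_neg ha hp, ha']⟩

lemma rankOne_mem_schattenSphere {x y : H} (hx : ‖x‖ = 1) (hy : ‖y‖ = 1) {p : ℝ} (hp : 1 ≤ p) :
    InnerProductSpace.rankOne ℂ x y ∈ schattenSphere p H := by
  refine (mem_schattenSphere_iff hp).2 ⟨isCompactOperator_rankOne x y, ?_⟩
  rw [(isSchmidt_rankOne hx hy).schattenSum_eq (isCompactOperator_rankOne x y) hp]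
  simp

lemma orthogonal_rankOne {c : H →L[ℂ] H} {ξ η : H} (h1 : c η = 0) (h2 : ∀ x, ⟪ξ, c x⟫_ℂ = 0) :
    OpOrthogonal c (InnerProductSpace.rankOne ℂ ξ η) := by
  constructor
  · ext x
    simp [ContinuousLinearMap.star_eq_adjoint, h1]
  · ext x
    simp [ContinuousLinearMap.star_eq_adjoint, h2]

/-- Vectors orthogonal to the antipodes `{x : ‖c - x‖ = 2}` of `c` control `a`. -/
lemma inner_apply_eq_zero_of_antipodes {a c : H →L[ℂ] H} (ha : a ∈ schattenSphere 1 H)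
    (hc : c ∈ schattenSphere 1 H)
    (hac : ∀ x ∈ schattenSphere 1 H, schattenSum 1 (c - x) = 2 → schattenSum 1 (a - x) = 2)
    {ξ η : H} (hη : ‖η‖ = 1) (hcη : c η = 0) (hcξ : ∀ x, ⟪ξ, c x⟫_ℂ = 0) (x : H) :
    ⟪ξ, a x⟫_ℂ = 0 := by
  obtain ⟨ha₀, ha'⟩ := (mem_schattenSphere_iff le_rfl).1 ha
  obtain ⟨hc₀, hc'⟩ := (mem_schattenSphere_iff le_rfl).1 hc
  have key : ∀ ξ : H, ‖ξ‖ = 1 → (∀ x, ⟪ξ, c x⟫_ℂ = 0) →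
      schattenSum 1 (a - InnerProductSpace.rankOne ℂ ξ η) = 2 := by
    intro ξ hξ hcξ
    have hy := rankOne_mem_schattenSphere hξ hη le_rfl
    have ho := orthogonal_rankOne hcη hcξ
    set y : H →L[ℂ] H := InnerProductSpace.rankOne ℂ ξ η
    obtain ⟨hy₀, hy'⟩ := (mem_schattenSphere_iff le_rfl).1 hy
    have h1 : schattenSum 1 (-c + y) = 2 := by
      have := schattenSum_add_of_orthogonal hc₀.neg hy₀ le_rfl
        (by simpa using ho.smul_smul (-1) 1 : OpOrthogonal (-c) y)
      rw [this, schattenSum_neg hc₀ le_rfl, hc', hy', one_add_one_eq_two]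
    -- The point `(-c + y) / 2` is an antipode of `c`: by orthogonality `‖3 c - y‖₁ = 3 + 1`.
    have h2 : c - (2⁻¹ : ℂ) • (-c + y) = (2⁻¹ : ℂ) • ((3 : ℂ) • c + (-1 : ℂ) • y) := by
      module
    have h3 : schattenSum 1 ((3 : ℂ) • c + (-1 : ℂ) • y) = 4 := by
      rw [schattenSum_add_of_orthogonal (hc₀.smul (3 : ℂ)) (hy₀.smul (-1 : ℂ)) le_rfl
        (ho.smul_smul _ _), schattenSum_smul hc₀ le_rfl (by simp),
        schattenSum_smul hy₀ le_rfl (by simp), hc', hy', ← ofReal_norm, ← ofReal_norm]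
      simp only [RCLike.norm_ofNat, norm_neg, norm_one, ENNReal.ofReal_ofNat, ENNReal.rpow_one,
        mul_one, ENNReal.ofReal_one]
      norm_num
    have hcy : IsCompactOperator (-c + y) := hc₀.neg.add hy₀
    have h4 : schattenSum 1 (c - (2⁻¹ : ℂ) • (-c + y)) = 2 := by
      have hcy' : IsCompactOperator ((3 : ℂ) • c + (-1 : ℂ) • y) :=
        (hc₀.smul (3 : ℂ)).add (hy₀.smul (-1 : ℂ))
      rw [h2, schattenSum_one_half_smul hcy', h3, (by norm_num : (4 : ℝ≥0∞) = 2 * 2),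
        ← mul_assoc, ENNReal.inv_mul_cancel two_ne_zero ENNReal.ofNat_ne_top, one_mul]
    have h5 := hac _ (half_smul_mem_schattenSphere hcy h1) h4
    have h6 : a - (2⁻¹ : ℂ) • (-c + y) = (2⁻¹ : ℂ) • ((a - (-c)) + (a - y)) := by
      module
    rw [h6] at h5
    exact (schattenSum_one_of_two_halves (ha₀.sub hc₀.neg) (ha₀.sub hy₀)
      (schattenSum_sub_le_two ha (neg_mem_schattenSphere le_rfl hc))
      (schattenSum_sub_le_two ha hy) h5).2
  have main : ∀ ξ : H, ‖ξ‖ = 1 → (∀ x, ⟪ξ, c x⟫_ℂ = 0) → ⟪ξ, a x⟫_ℂ = 0 := by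
    intro ξ hξ hcξ
    have h1 := key ξ hξ hcξ
    have h2 := key (-ξ) (by rwa [norm_neg]) (fun x => by rw [inner_neg_left, hcξ, neg_zero])
    obtain ⟨hy₀, hy'⟩ := (mem_schattenSphere_iff le_rfl).1 (rankOne_mem_schattenSphere hξ hη le_rfl)
    have h3 : InnerProductSpace.rankOne ℂ (-ξ) η = -(InnerProductSpace.rankOne ℂ ξ η) := by
      ext z; simp
    rw [h3, sub_neg_eq_add] at h2
    -- Both `a - y` and `a + y` have norm 2, so `a` is orthogonal to the rank-one operator `y`.
    have ho := orthogonal_of_clarkson_eq ha₀ hy₀ le_rfl (by norm_num) (by simp [ha'])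
      (by simp [hy']) (by rw [h1, h2, ha', hy']; norm_num)
    have h4 := congrArg (fun T : H →L[ℂ] H => T x) ho.2
    have hη0 : η ≠ 0 := fun h => by simp [h] at hη
    simpa [ContinuousLinearMap.star_eq_adjoint, hη0] using h4
  rcases eq_or_ne ξ 0 with rfl | hξ
  · simp
  · have hn : ‖ξ‖ ≠ 0 := norm_ne_zero_iff.2 hξ
    have h1 := main (((‖ξ‖⁻¹ : ℝ) : ℂ) • ξ)
      (by rw [norm_smul, Complex.norm_real, norm_inv, norm_norm, inv_mul_cancel₀ hn])
      (fun x => by rw [inner_smul_left, hcξ, mul_zero])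
    rw [inner_smul_left] at h1
    simpa [hn] using h1

/-- A metric description, inside the unit sphere of the trace class, of the pairs on which the
trace norm is additive. -/
theorem schattenSum_one_add_eq_two_iff {a b : H →L[ℂ] H} (ha : a ∈ schattenSphere 1 H)
    (hb : b ∈ schattenSphere 1 H) :
    schattenSum 1 (a + b) = 2 ↔ ∃ c ∈ schattenSphere 1 H, ∀ x ∈ schattenSphere 1 H,
      schattenSum 1 (c - x) = 2 → schattenSum 1 (a - x) = 2 ∧ schattenSum 1 (b - x) = 2 := by
  obtain ⟨ha₀, ha'⟩ := (mem_schattenSphere_iff le_rfl).1 ha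
  obtain ⟨hb₀, hb'⟩ := (mem_schattenSphere_iff le_rfl).1 hb
  constructor
  · intro h
    -- The midpoint serves as `c`: a point at distance 2 from it must be at distance 2 from each
    -- end, as neither distance exceeds 2.
    refine ⟨(2⁻¹ : ℂ) • (a + b), half_smul_mem_schattenSphere (ha₀.add hb₀) h, fun x hx hcx => ?_⟩
    have hx₀ := ((mem_schattenSphere_iff le_rfl).1 hx).1
    have h1 : (2⁻¹ : ℂ) • (a + b) - x = (2⁻¹ : ℂ) • ((a - x) + (b - x)) := by module
    rw [h1] at hcx
    exact schattenSum_one_of_two_halves (ha₀.sub hx₀) (hb₀.sub hx₀)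
      (schattenSum_sub_le_two ha hx) (schattenSum_sub_le_two hb hx) hcx
  · rintro ⟨c, hc, hcx⟩
    obtain ⟨hc₀, hc'⟩ := (mem_schattenSphere_iff le_rfl).1 hc
    obtain ⟨ι, σ, u, v, h₁, hσ⟩ := exists_isSchmidt ha₀
    obtain ⟨ι', σ', u', v', h₂, hσ'⟩ := exists_isSchmidt hb₀
    obtain ⟨κ, ζ, e, f, h, hζ⟩ := exists_isSchmidt hc₀
    -- The antipode `-c` shows that the norm is additive on `a, c` and on `b, c`. It remains to see
    -- that `V`, obtained from `b` and `c`, also inverts the polar part of `a`.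
    have h3 : schattenSum 1 (c - -c) = 2 := by
      have : c - -c = (2 : ℂ) • c := by module
      rw [this, schattenSum_smul hc₀ le_rfl (by simp), hc', ← ofReal_norm]
      simp
    obtain ⟨h4, h5⟩ := hcx _ (neg_mem_schattenSphere le_rfl hc) h3
    rw [sub_neg_eq_add] at h4 h5
    obtain ⟨U, hU, hUa, hUc⟩ := exists_contraction_of_midpoint h₁ h ha₀ hc₀ ha' hc'
      ((mem_schattenSphere_iff le_rfl).1 (half_smul_mem_schattenSphere (ha₀.add hc₀) h4)).2
    obtain ⟨V, hV, hVb, hVc⟩ := exists_contraction_of_midpoint h₂ h hb₀ hc₀ hb' hc'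
      ((mem_schattenSphere_iff le_rfl).1 (half_smul_mem_schattenSphere (hb₀.add hc₀) h5)).2
    have hVa : ∀ i, V (v i) = u i := by
      intro i
      rw [← hUa i]
      by_cases hker : ∀ w, (∀ k, ⟪e k, w⟫_ℂ = 0) → w = 0
      · have hst : star V = star U := by
          refine eq_of_forall_orthogonal (u := e) (fun k => ?_) fun w hw => by simp [hker w hw]
          rw [star_apply_of_contraction hV (h.right.1 k) (h.left.1 k) (hVc k),
            star_apply_of_contraction hU (h.right.1 k) (h.left.1 k) (hUc k)]
        rw [star_injective hst]
      -- Otherwise a unit vector `η` in the kernel of `c` is available, and the antipode condition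
      -- puts `v i` in the closed span of `f`, where `U` and `V` agree.
      · push Not at hker
        obtain ⟨w, hw, hw0⟩ := hker
        have hn : ‖w‖ ≠ 0 := norm_ne_zero_iff.2 hw0
        refine apply_eq_of_forall_orthogonal (u := f) (fun k => by rw [hVc, hUc]) fun ξ hξ => ?_
        have h6 := inner_apply_eq_zero_of_antipodes ha hc (fun x hx h => (hcx x hx h).1)
          (ξ := ξ) (η := ((‖w‖⁻¹ : ℝ) : ℂ) • w)
          (by rw [norm_smul, Complex.norm_real, norm_inv, norm_norm, inv_mul_cancel₀ hn])
          (by rw [map_smul, h.apply_eq_zero hw, smul_zero])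
          (fun x => by
            refine (h.hasSum x ξ).unique ?_
            have : ∀ k, ⟪ξ, f k⟫_ℂ = 0 := fun k => inner_eq_zero_symm.1 (hξ k)
            simp [this]) (u i)
        rw [h₁.apply_left, inner_smul_right] at h6
        simpa [(h₁.pos i).ne'] using h6
    rw [schattenSum_one_add_of_contraction h₁ h₂ ha₀ hb₀ hV hVa hVb, ha', hb', one_add_one_eq_two]

end TraceNorm

/-! ### Cardinality of orthonormal families. -/

section Dimension

variable {H : Type*} [NormedAddCommGroup H] [InnerProductSpace ℂ H]

/-- An orthonormal family is at most as large as a Hilbert basis. -/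
theorem HilbertBasis.lift_mk_le_of_orthonormal.{w, w'} {ι : Type w} {κ : Type w'}
    (b : HilbertBasis ι ℂ H) {v : κ → H} (hv : Orthonormal ℂ v) :
    Cardinal.lift.{w} (Cardinal.mk κ) ≤ Cardinal.lift.{w'} (Cardinal.mk ι) := by
  rcases finite_or_infinite ι with hι | hι
  · have := Fintype.ofFinite ι
    have B := b.toOrthonormalBasis.toBasis
    have : FiniteDimensional ℂ H := B.finiteDimensional_of_finite
    have hli := hv.linearIndependent
    have : Finite κ := hli.finite
    have := Fintype.ofFinite κ
    have h1 := hli.fintype_card_le_finrank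
    rw [Module.finrank_eq_card_basis B] at h1
    simpa using h1
  -- Each `v k` is sent to an index where its coefficient is nonzero; by Bessel the fibres are
  -- countable, so the cardinality is at most `#ι * ℵ₀ = #ι`.
  · have hex : ∀ k, ∃ i, ⟪b i, v k⟫_ℂ ≠ 0 := by
      intro k
      by_contra! hc
      have h0 : v k = 0 := by
        have h1 := b.hasSum_repr (v k)
        simp only [b.repr_apply_apply, hc, zero_smul] at h1
        exact h1.unique hasSum_zero
      exact hv.ne_zero k h0
    choose f hf using hex
    have hfib : ∀ i, Cardinal.lift.{w} (Cardinal.mk (f ⁻¹' {i})) ≤ Cardinal.aleph0 := by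
      intro i
      rw [Cardinal.lift_le_aleph0, Cardinal.le_aleph0_iff_set_countable]
      refine (hv.inner_products_summable (b i)).countable_support.mono ?_
      rintro k rfl
      have h1 : ⟪v k, b (f k)⟫_ℂ ≠ 0 := fun h => hf k (inner_eq_zero_symm.1 h)
      simpa using h1
    have h1 := Cardinal.lift_mk_le_lift_mk_mul_of_lift_mk_preimage_le f hfib
    refine h1.trans (le_of_eq ?_)
    rw [Cardinal.mul_aleph0_eq]
    rw [Cardinal.aleph0_le_lift]
    exact Cardinal.aleph0_le_mk ι

end Dimension

/-! ### Orthogonality through norms, and its transport by the isometry. -/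

section Main

/-- Orthogonality on the unit sphere in terms of norms. -/
theorem opOrthogonal_iff {H : Type*} [NormedAddCommGroup H] [InnerProductSpace ℂ H]
    [CompleteSpace H] {p : ℝ} (hp : 1 ≤ p) (hp2 : p ≠ 2) {a b : H →L[ℂ] H}
    (ha : a ∈ schattenSphere p H) (hb : b ∈ schattenSphere p H) :
    OpOrthogonal a b ↔ schattenSum p (a + b) = 2 ∧ schattenSum p (a - b) = 2 := by
  obtain ⟨ha, ha'⟩ := (mem_schattenSphere_iff hp).1 ha
  obtain ⟨hb, hb'⟩ := (mem_schattenSphere_iff hp).1 hb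
  constructor
  · intro h
    have h' : OpOrthogonal a (-b) := by simpa using h.smul_smul 1 (-1)
    constructor
    · rw [schattenSum_add_of_orthogonal ha hb hp h, ha', hb', one_add_one_eq_two]
    · rw [sub_eq_add_neg, schattenSum_add_of_orthogonal ha hb.neg hp h', schattenSum_neg hb hp,
        ha', hb', one_add_one_eq_two]
  · rintro ⟨h1, h2⟩
    refine orthogonal_of_clarkson_eq ha hb hp hp2 (by simp [ha']) (by simp [hb']) ?_
    rw [h1, h2, ha', hb']
    norm_num

lemma schattenSum_eq_iff_schattenNorm_eq {H H' : Type*} [NormedAddCommGroup H]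
    [InnerProductSpace ℂ H] [CompleteSpace H] [NormedAddCommGroup H'] [InnerProductSpace ℂ H']
    [CompleteSpace H'] {p : ℝ} (hp : 1 ≤ p) {a : H →L[ℂ] H} {b : H' →L[ℂ] H'} :
    schattenNorm p a = schattenNorm p b ↔ schattenSum p a = schattenSum p b :=
  (ENNReal.rpow_left_injective (by positivity : 1 / p ≠ 0)).eq_iff

/-- Orthogonal operators have orthogonal ranges; one unit vector is picked in each. -/
lemma orthonormal_of_opOrthogonal {H : Type*} [NormedAddCommGroup H] [InnerProductSpace ℂ H]
    [CompleteSpace H] {ι : Type*} {A : ι → H →L[ℂ] H} (h0 : ∀ i, A i ≠ 0)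
    (hA : ∀ i j, i ≠ j → OpOrthogonal (A i) (A j)) : ∃ v : ι → H, Orthonormal ℂ v := by
  have h1 : ∀ i, ∃ x, A i x ≠ 0 := fun i => by
    by_contra! hc
    exact h0 i (ContinuousLinearMap.ext hc)
  choose x hx using h1
  refine ⟨fun i => ((‖A i (x i)‖⁻¹ : ℝ) : ℂ) • A i (x i), fun i => ?_, fun i j hij => ?_⟩
  · rw [norm_smul, Complex.norm_real, norm_inv, norm_norm, inv_mul_cancel₀ (norm_ne_zero_iff.2 (hx i))]
  · have h2 := congrArg (fun T : H →L[ℂ] H => ⟪x i, T (x j)⟫_ℂ) (hA j i hij.symm).2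
    simp only [mul_apply_eq_comp, ContinuousLinearMap.star_eq_adjoint,
      ContinuousLinearMap.adjoint_inner_right, zero_apply, inner_zero_right] at h2
    simp only [inner_smul_left, inner_smul_right, h2, mul_zero]

/-- A map between unit spheres preserving orthogonality does not decrease the dimension. -/
lemma lift_mk_le_of_opOrthogonal.{w, w'} {H H' : Type*} [NormedAddCommGroup H]
    [InnerProductSpace ℂ H] [CompleteSpace H] [NormedAddCommGroup H'] [InnerProductSpace ℂ H']
    [CompleteSpace H'] {p : ℝ} (hp : 1 ≤ p) (Φ : schattenSphere p H → schattenSphere p H')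
    (hΦ : ∀ a b : schattenSphere p H, OpOrthogonal (a : H →L[ℂ] H) (b : H →L[ℂ] H) →
      OpOrthogonal (Φ a : H' →L[ℂ] H') (Φ b : H' →L[ℂ] H')) {ι : Type w} {ι' : Type w'}
    (e : HilbertBasis ι ℂ H) (e' : HilbertBasis ι' ℂ H') :
    Cardinal.lift.{w'} (Cardinal.mk ι) ≤ Cardinal.lift.{w} (Cardinal.mk ι') := by
  let E : ι → schattenSphere p H := fun i =>
    ⟨_, rankOne_mem_schattenSphere (e.orthonormal.1 i) (e.orthonormal.1 i) hp⟩
  have hE : ∀ i j, i ≠ j → OpOrthogonal (E i : H →L[ℂ] H) (E j : H →L[ℂ] H) := by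
    intro i j hij
    refine orthogonal_rankOne ?_ fun x => ?_
    · simp [E, e.orthonormal.2 hij]
    · simp [E, e.orthonormal.2 hij.symm]
  obtain ⟨v, hv⟩ := orthonormal_of_opOrthogonal (A := fun i => (Φ (E i) : H' →L[ℂ] H'))
    -- The zero operator is orthogonal to itself, so additivity on the sphere would read `1 = 1 +
    -- 1`.
    (fun i h0 => by
      obtain ⟨h1, h2⟩ := (mem_schattenSphere_iff hp).1 (Φ (E i)).2
      have h3 := schattenSum_add_of_orthogonal h1 h1 hp
        (by simp [OpOrthogonal, h0] : OpOrthogonal (Φ (E i) : H' →L[ℂ] H') (Φ (E i)))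
      rw [h0, add_zero, ← h0, h2] at h3
      norm_num at h3)
    (fun i j hij => hΦ _ _ (hE i j hij))
  exact e'.lift_mk_le_of_orthonormal hv

section Isometry

variable {H H' : Type*} [NormedAddCommGroup H] [InnerProductSpace ℂ H] [CompleteSpace H]
  [NormedAddCommGroup H'] [InnerProductSpace ℂ H'] [CompleteSpace H']

/-- For `1 < p`, isometries between unit spheres are odd. -/
lemma coe_neg_of_isometry {p : ℝ} (hp : 1 < p) {Δ : schattenSphere p H → schattenSphere p H'}
    (hisom : ∀ a b : schattenSphere p H, schattenSum p ((Δ a : H' →L[ℂ] H') - (Δ b : H' →L[ℂ] H')) =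
      schattenSum p ((a : H →L[ℂ] H) - (b : H →L[ℂ] H))) (b : schattenSphere p H) :
    (Δ ⟨-b, neg_mem_schattenSphere hp.le b.2⟩ : H' →L[ℂ] H') = -(Δ b : H' →L[ℂ] H') := by
  set c := Δ ⟨-b, neg_mem_schattenSphere hp.le b.2⟩
  obtain ⟨hb, hb'⟩ := (mem_schattenSphere_iff hp.le).1 b.2
  obtain ⟨hc, hc'⟩ := (mem_schattenSphere_iff hp.le).1 c.2
  obtain ⟨hd, hd'⟩ := (mem_schattenSphere_iff hp.le).1 (Δ b).2
  have h1 := hisom b ⟨-b, neg_mem_schattenSphere hp.le b.2⟩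
  have h2 : (b : H →L[ℂ] H) - -(b : H →L[ℂ] H) = (2 : ℂ) • (b : H →L[ℂ] H) := by module
  rw [h2, schattenSum_smul hb hp.le two_ne_zero, hb', mul_one] at h1
  -- The distance from `Δ b` to `c` equals `‖2 b‖_p = 2`, so the midpoint of `Δ b` and `-c` lies on
  -- the sphere.
  have h3 : schattenSum p ((2⁻¹ : ℂ) • ((Δ b : H' →L[ℂ] H') + -(c : H' →L[ℂ] H'))) = 1 := by
    rw [← sub_eq_add_neg, schattenSum_smul (hd.sub hc) hp.le (by simp), h1,
      ← ENNReal.mul_rpow_of_nonneg _ _ (by linarith), ← enorm_mul]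
    simp
  have h4 := eq_of_schattenSum_midpoint hd hc.neg hp hd'
    (by rw [schattenSum_neg hc hp.le, hc']) h3
  rw [h4, neg_neg]

/-- The condition on `a - b` is carried over directly. That on `a + b` follows from oddness for `1 <
p`; for `p = 1` the witness `c` is transported, with surjectivity supplying the quantifier over the
whole target sphere. -/
lemma opOrthogonal_iff_of_isometry {p : ℝ} (hp : 1 ≤ p) (hp2 : p ≠ 2)
    {Δ : schattenSphere p H → schattenSphere p H'} (hsurj : Function.Surjective Δ)
    (hisom : ∀ a b : schattenSphere p H, schattenSum p ((Δ a : H' →L[ℂ] H') - (Δ b : H' →L[ℂ] H')) =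
      schattenSum p ((a : H →L[ℂ] H) - (b : H →L[ℂ] H))) (a b : schattenSphere p H) :
    OpOrthogonal (a : H →L[ℂ] H) (b : H →L[ℂ] H) ↔
      OpOrthogonal (Δ a : H' →L[ℂ] H') (Δ b : H' →L[ℂ] H') := by
  rw [opOrthogonal_iff hp hp2 a.2 b.2, opOrthogonal_iff hp hp2 (Δ a).2 (Δ b).2, hisom]
  refine and_congr_left fun _ => ?_
  rcases hp.eq_or_lt with rfl | hp1
  · rw [schattenSum_one_add_eq_two_iff a.2 b.2, schattenSum_one_add_eq_two_iff (Δ a).2 (Δ b).2]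
    constructor
    · rintro ⟨c, hc, hcx⟩
      refine ⟨Δ ⟨c, hc⟩, (Δ ⟨c, hc⟩).2, fun x hx => ?_⟩
      obtain ⟨y, hy⟩ := hsurj ⟨x, hx⟩
      have hy' : x = Δ y := by rw [hy]
      rw [hy', hisom, hisom, hisom]
      exact hcx y y.2
    · rintro ⟨c, hc, hcx⟩
      obtain ⟨d, hd⟩ := hsurj ⟨c, hc⟩
      have hd' : c = Δ d := by rw [hd]
      refine ⟨d, d.2, fun x hx => ?_⟩
      have := hcx _ (Δ ⟨x, hx⟩).2
      rwa [hd', hisom, hisom, hisom] at this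
  · have h := hisom a ⟨-b, neg_mem_schattenSphere hp b.2⟩
    rw [coe_neg_of_isometry hp1 hisom, sub_neg_eq_add, sub_neg_eq_add] at h
    rw [h]

end Isometry

end Main

theorem lemmal {H H' : Type*}
    [NormedAddCommGroup H] [InnerProductSpace ℂ H] [CompleteSpace H]
    [NormedAddCommGroup H'] [InnerProductSpace ℂ H'] [CompleteSpace H']
    (p : ℝ) (hp : 1 ≤ p) (hp2 : p ≠ 2)
    (Δ : schattenSphere p H → schattenSphere p H')
    (hsurj : Function.Surjective Δ)
    (hisom : ∀ a b : schattenSphere p H,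
      schattenNorm p ((Δ a : H' →L[ℂ] H') - (Δ b : H' →L[ℂ] H')) =
        schattenNorm p ((a : H →L[ℂ] H) - (b : H →L[ℂ] H))) :
    (∀ a b : schattenSphere p H,
      OpOrthogonal (a : H →L[ℂ] H) (b : H →L[ℂ] H) ↔
        OpOrthogonal (Δ a : H' →L[ℂ] H') (Δ b : H' →L[ℂ] H')) ∧
    (∀ (ι ι' : Type*), HilbertBasis ι ℂ H → HilbertBasis ι' ℂ H' → Nonempty (ι ≃ ι')) := by
  have horth := opOrthogonal_iff_of_isometry hp hp2 hsurj
    fun a b => (schattenSum_eq_iff_schattenNorm_eq hp).1 (hisom a b)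
  refine ⟨horth, fun ι ι' e e' => ?_⟩
  rw [← Cardinal.lift_mk_eq']
  -- A right inverse of `Δ` also preserves orthogonality, by the reverse implication.
  refine le_antisymm (lift_mk_le_of_opOrthogonal hp Δ (fun a b => (horth a b).1) e e')
    (lift_mk_le_of_opOrthogonal hp (Function.surjInv hsurj) (fun a b hab => ?_) e' e)
  rw [horth, Function.surjInv_eq hsurj, Function.surjInv_eq hsurj]
  exact hab
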